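/- Let $n\ge 2$, $1<p<\infty$, $\kappa>0$, and write points of $\mathbf{R}^n$ as $x=(x',x_n)$ with $x'\in\mathbf{R}^{n-1}$, $x_n\in\mathbf{R}$. Let $G=B'\times(0,\infty)$, where $B'=\{x'\in\mathbf{R}^{n-1}:|x'|<1\}$, and let $F\subset\overline G$ be a closed set containing the base $B'\times\{0\}$. *The operator $\mathcal A$.* Let $\mathcal A:\overline G\times\mathbf{R}^n\to\mathbf{R}^n$ be such that $\mathcal A(\cdot,q)$ is measurable for every $q\in\mathbf{R}^n$, $\mathcal A(x,\cdot)$ is continuous for a.e. $x\in\overline G$, and there are constants $0<\alpha_1\le\alpha_2<\infty$ such that for all $q,q_1,q_2\in\mathbf{R}^n$, $0\ne\lambda\in\mathbf{R}$ and a.e. $x\in\overline G$, $$\mathcal A(x,q)\cdot q\ge\alpha_1|q|^p,\qquad |\mathcal A(x,q)|\le\alpha_2|q|^{p-1},\qquad \mathcal A(x,\lambda q)=\lambda|\lambda|^{p-2}\mathcal A(x,q),$$ $$(\mathcal A(x,q_1)-\mathcal A(x,q_2))\cdot(q_1-q_2)>0\quad\text{when } q_1\ne q_2.$$ *The transformation.*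 Let $T(x',x_n)=(\xi',\xi_n)$ with $$\xi'=\frac{2e^{-\kappa x_n}x'}{1+|x'|^2},\qquad \xi_n=\frac{e^{-\kappa x_n}(1-|x'|^2)}{1+|x'|^2},$$ a diffeomorphism of $\mathbf{R}^n$ onto $\mathbf{R}^n\setminus\{\xi:\xi'=0,\ \xi_n\le0\}$, and let $P(\xi',\xi_n)=(\xi',-\xi_n)$. Let $D=B(0,1)\setminus\widetilde F$, where $\widetilde F=T(F)\cup PT(F)\cup\{0\}$, and let $\widetilde w(\xi)=|\xi|^{p-n}$. Define, for $\xi=Tx\in T(\overline G)$ and $q\in\mathbf{R}^n$, $$\mathcal B(\xi,q)=|J_T(x)|^{-1}\,dT(x)\,\mathcal A(x,dT^*(x)q),$$ where $dT^*(x)$ is the transpose of the differential $dT(x)$ and $J_T=\det dT$; extend $\mathcal B$ by $\mathcal B(\xi,q)=P\mathcal B(P\xi,Pq)$ for $\xi\in PT(\overline G)$ with $\xi_n<0$, and $\mathcal B(0,q)=0$. *Function spaces and weak solutions.* For an open set $\Omega\subset\mathbf{R}^n$, $H^{1,p}(\Omega,\widetilde w)$ is the completion of $\{\varphi\in C^\infty(\Omega):\|\varphi\|<\infty\}$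 in the norm $\|\varphi\|=\bigl(\int_\Omega(|\varphi|^p+|\nabla\varphi|^p)\,\widetilde w\,d\xi\bigr)^{1/p}$; it is denoted $W^{1,p}(\Omega)$ if $\widetilde w$ is replaced by $1$. The local spaces consist of the functions that belong to the corresponding space on every open $\Omega'$ whose closure is a compact subset of $\Omega$. Let $W^{1,p}_{\rm loc}(\overline G\setminus F)$ be the set of restrictions to $\overline G\setminus F$ of functions in $W^{1,p}_{\rm loc}(\mathbf{R}^n\setminus F)$. A function $u\in W^{1,p}_{\rm loc}(\overline G\setminus F)$ is a weak solution of $\operatorname{div}\mathcal A(x,\nabla u)=0$ in $G\setminus F$ with zero conormal derivative on $\partial G\setminus F$ if $$\int_{G\setminus F}\mathcal A(x,\nabla u)\cdot\nabla\varphi\,dx=0\qquad\text{for all }\varphi\in C_0^\infty(\mathbf{R}^n\setminus F),$$ and $v\in H^{1,p}_{\rm loc}(D,\widetilde w)$ is a weak solution of $\operatorname{div}\mathcal B(\xi,\nabla v)=0$ in $D$ if $$\int_{D}\mathcal B(\xi,\nabla v)\cdot\nabla\varphi\,d\xi=0\qquad\text{for all }\varphi\in C_0^\infty(D).$$ **Theorem.**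 (a) Let $u\in W^{1,p}_{\rm loc}(\overline G\setminus F)$ be a weak solution of $\operatorname{div}\mathcal A(x,\nabla u)=0$ in $G\setminus F$ with zero conormal derivative on $\partial G\setminus F$, and let $$\tilde u(\xi)=\begin{cases}(u\circ T^{-1})(\xi)&\text{if }\xi\in T(\overline G\setminus F),\\ (u\circ T^{-1})(P\xi)&\text{if }\xi\in PT(G\setminus F).\end{cases}$$ Then $\tilde u\in H^{1,p}_{\rm loc}(D,\widetilde w)$, and $\tilde u$ is a weak solution of $\operatorname{div}\mathcal B(\xi,\nabla\tilde u)=0$ in $D$. (b) Conversely, if $\bar u\in H^{1,p}_{\rm loc}(D,\widetilde w)$ is a weak solution of $\operatorname{div}\mathcal B(\xi,\nabla\bar u)=0$ in $D$ such that $\bar u=\bar u\circ P$ (a.e. in $D$), then $\bar u\circ T$, with $\bar u$ restricted to $T(\overline G\setminus F)$, belongs to $W^{1,p}_{\rm loc}(\overline G\setminus F)$ and is a weak solution of $\operatorname{div}\mathcal A(x,\nabla u)=0$ in $G\setminus F$ with zero conormal derivative on $\partial G\setminus F$. -/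

import Mathlib

open MeasureTheory Filter Topology
open scoped ContDiff ENNReal

noncomputable section

namespace HalfCylinder

/-- Euclidean space `ℝⁿ` with `n = m + 1`, whose points are written `x = (x', xₙ)`
with `x' ∈ ℝᵐ` and `xₙ ∈ ℝ`. -/
abbrev E (m : ℕ) : Type := EuclideanSpace ℝ (Fin (m + 1))

/-- The first component `x'` of `x = (x', xₙ)`. -/
def hor {m : ℕ} (x : E m) : EuclideanSpace ℝ (Fin m) :=
  WithLp.toLp 2 (fun i : Fin m => x i.castSucc)

/-- The last coordinate `xₙ` of `x = (x', xₙ)`. -/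
def ht {m : ℕ} (x : E m) : ℝ := x (Fin.last m)

/-- The point `(y, t)`. -/
def pt {m : ℕ} (y : EuclideanSpace ℝ (Fin m)) (t : ℝ) : E m :=
  WithLp.toLp 2 (Fin.snoc (α := fun _ => ℝ) (fun i : Fin m => y i) t)

@[simp] theorem hor_pt {m : ℕ} (y : EuclideanSpace ℝ (Fin m)) (t : ℝ) : hor (pt y t) = y := by
  ext i; simp [hor, pt]

@[simp] theorem ht_pt {m : ℕ} (y : EuclideanSpace ℝ (Fin m)) (t : ℝ) : ht (pt y t) = t := by
  simp [ht, pt]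

@[simp] theorem pt_hor_ht {m : ℕ} (x : E m) : pt (hor x) (ht x) = x := by
  ext i
  refine Fin.lastCases ?_ (fun j => ?_) i <;> simp [hor, ht, pt]

theorem norm_sq_eq {m : ℕ} (x : E m) : ‖x‖ ^ 2 = ‖hor x‖ ^ 2 + ht x ^ 2 := by
  simp [EuclideanSpace.norm_sq_eq, Fin.sum_univ_castSucc, hor, ht]

/-! ### The half-cylinder, the change of variables and the reflection -/

/-- The open half-cylinder `G = B' × (0, ∞)`. -/
def G (m : ℕ) : Set (E m) := {x | ‖hor x‖ < 1 ∧ 0 < ht x}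

/-- The base `B' × {0}` of the half-cylinder. -/
def base (m : ℕ) : Set (E m) := {x | ‖hor x‖ < 1 ∧ ht x = 0}

/-- The change of variables `T`. -/
def T {m : ℕ} (κ : ℝ) (x : E m) : E m :=
  pt ((2 * Real.exp (-κ * ht x) / (1 + ‖hor x‖ ^ 2)) • hor x)
    (Real.exp (-κ * ht x) * (1 - ‖hor x‖ ^ 2) / (1 + ‖hor x‖ ^ 2))

/-- The inverse of `T`, given by its explicit formula; it is meaningful off the closed half-line
`{ξ' = 0, ξₙ ≤ 0}`, see `Tinv_T` and `T_Tinv`. -/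
def Tinv {m : ℕ} (κ : ℝ) (ξ : E m) : E m :=
  pt ((‖ξ‖ + ht ξ)⁻¹ • hor ξ) (-(1 / κ) * Real.log ‖ξ‖)

theorem norm_T {m : ℕ} (κ : ℝ) (x : E m) : ‖T κ x‖ = Real.exp (-κ * ht x) := by
  have h : ‖T κ x‖ ^ 2 = Real.exp (-κ * ht x) ^ 2 := by
    have h1 : (1 + ‖hor x‖ ^ 2) ≠ 0 := by positivity
    rw [norm_sq_eq]
    simp only [T, hor_pt, ht_pt, norm_smul, Real.norm_eq_abs, mul_pow, sq_abs]
    field_simp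
    ring
  exact (sq_eq_sq₀ (norm_nonneg _) (Real.exp_pos _).le).1 h

theorem Tinv_T {m : ℕ} {κ : ℝ} (hκ : 0 < κ) (x : E m) : Tinv κ (T κ x) = x := by
  have h1 : (1 + ‖hor x‖ ^ 2) ≠ 0 := by positivity
  have h2 := (Real.exp_pos (-κ * ht x)).ne'
  have h3 : ‖T κ x‖ + ht (T κ x) = 2 * Real.exp (-κ * ht x) / (1 + ‖hor x‖ ^ 2) := by
    rw [norm_T]
    simp only [T, ht_pt]
    field_simp
    ring
  have h4 : 2 * Real.exp (-κ * ht x) / (1 + ‖hor x‖ ^ 2) ≠ 0 := by positivity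
  have h5 : (‖T κ x‖ + ht (T κ x))⁻¹ • hor (T κ x) = hor x := by
    rw [h3]
    simp only [T, hor_pt, smul_smul]
    rw [inv_mul_cancel₀ h4, one_smul]
  have h6 : -(1 / κ) * Real.log ‖T κ x‖ = ht x := by
    rw [norm_T, Real.log_exp]
    field_simp
  rw [Tinv, h5, h6, pt_hor_ht]

theorem T_Tinv {m : ℕ} {κ : ℝ} (hκ : 0 < κ) (ξ : E m) (hξ : ¬ (hor ξ = 0 ∧ ht ξ ≤ 0)) :
    T κ (Tinv κ ξ) = ξ := by
  have hs := norm_sq_eq ξ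
  have hpos : 0 < ‖ξ‖ + ht ξ := by
    by_contra hc
    push Not at hc
    have h0 := norm_nonneg ξ
    have h1 : ht ξ ≤ 0 := by linarith
    have h2 : ‖hor ξ‖ ^ 2 ≤ 0 := by nlinarith
    exact hξ ⟨by simpa using le_antisymm h2 (sq_nonneg _), h1⟩
  have hne : ξ ≠ 0 := by
    rintro rfl
    simp [ht] at hpos
  have hn : 0 < ‖ξ‖ := norm_pos_iff.2 hne
  have he : Real.exp (-κ * (-(1 / κ) * Real.log ‖ξ‖)) = ‖ξ‖ := by
    rw [show -κ * (-(1 / κ) * Real.log ‖ξ‖) = Real.log ‖ξ‖ by field_simp, Real.exp_log hn]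
  have hh : ‖(‖ξ‖ + ht ξ)⁻¹ • hor ξ‖ ^ 2 = (‖ξ‖ - ht ξ) / (‖ξ‖ + ht ξ) := by
    rw [norm_smul, mul_pow, Real.norm_eq_abs, sq_abs]
    field_simp
    nlinarith
  have hd : 1 + (‖ξ‖ - ht ξ) / (‖ξ‖ + ht ξ) = 2 * ‖ξ‖ / (‖ξ‖ + ht ξ) := by
    field_simp
    ring
  have a1 : (2 * ‖ξ‖ / (2 * ‖ξ‖ / (‖ξ‖ + ht ξ))) * (‖ξ‖ + ht ξ)⁻¹ = 1 := by
    field_simp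
  have a2 : ‖ξ‖ * (1 - (‖ξ‖ - ht ξ) / (‖ξ‖ + ht ξ)) / (2 * ‖ξ‖ / (‖ξ‖ + ht ξ)) = ht ξ := by
    field_simp
    ring
  rw [T]
  simp only [Tinv, hor_pt, ht_pt]
  rw [he, hh, hd, smul_smul, a1, a2, one_smul, pt_hor_ht]

/-- The reflection `P(ξ', ξₙ) = (ξ', -ξₙ)`. -/
def P {m : ℕ} (ξ : E m) : E m := pt (hor ξ) (-ht ξ)

/-- `F̃ = T(F) ∪ PT(F) ∪ {0}`. -/
def Ftilde {m : ℕ} (κ : ℝ) (F : Set (E m)) : Set (E m) :=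
  T κ '' F ∪ P '' (T κ '' F) ∪ {0}

/-- `D = B(0,1) ∖ F̃`. -/
def D {m : ℕ} (κ : ℝ) (F : Set (E m)) : Set (E m) := Metric.ball 0 1 \ Ftilde κ F

/-! ### Sobolev spaces -/

/-- `u` belongs to `H^{1,p}(Ω, μ)`, the completion of
`{φ ∈ C^∞(Ω) : ‖φ‖_p + ‖∇φ‖_p < ∞}` (norms in `L^p(Ω, μ)`), and `g` is its gradient: the pair
`(u, g)` is the limit in `L^p(Ω, μ)` of pairs `(φ k, ∇ (φ k))` of such smooth functions.
For `μ = volume` this is the Sobolev space `W^{1,p}(Ω)`. -/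
def IsSobolevGrad {m : ℕ} (μ : Measure (E m)) (p : ℝ) (Ω : Set (E m))
    (u : E m → ℝ) (g : E m → E m) : Prop :=
  MemLp u (ENNReal.ofReal p) (μ.restrict Ω) ∧
  MemLp g (ENNReal.ofReal p) (μ.restrict Ω) ∧
  ∃ φ : ℕ → E m → ℝ,
    (∀ k, ContDiffOn ℝ ∞ (φ k) Ω ∧
      MemLp (φ k) (ENNReal.ofReal p) (μ.restrict Ω) ∧
      MemLp (gradient (φ k)) (ENNReal.ofReal p) (μ.restrict Ω)) ∧
    Tendsto (fun k => eLpNorm (fun x => φ k x - u x) (ENNReal.ofReal p) (μ.restrict Ω))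
      atTop (𝓝 0) ∧
    Tendsto (fun k => eLpNorm (fun x => gradient (φ k) x - g x) (ENNReal.ofReal p)
      (μ.restrict Ω)) atTop (𝓝 0)

/-- `u ∈ H^{1,p}_loc(Ω, μ)` with gradient `g`: for every open `V ⋐ Ω`, `u ∈ H^{1,p}(V, μ)` with
gradient `g`. -/
def IsSobolevGradLoc {m : ℕ} (μ : Measure (E m)) (p : ℝ) (Ω : Set (E m))
    (u : E m → ℝ) (g : E m → E m) : Prop :=
  ∀ V : Set (E m), IsOpen V → IsCompact (closure V) → closure V ⊆ Ω → IsSobolevGrad μ p V u g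

/-- The weighted measure `|ξ|^{p-n} dξ`, `n = m + 1`. -/
def wMeasure (m : ℕ) (p : ℝ) : Measure (E m) :=
  volume.withDensity (fun ξ => ENNReal.ofReal (‖ξ‖ ^ (p - ((m : ℝ) + 1))))

/-- `φ ∈ C₀^∞(Ω)`. -/
def IsTestFun {m : ℕ} (Ω : Set (E m)) (φ : E m → ℝ) : Prop :=
  ContDiff ℝ ∞ φ ∧ HasCompactSupport φ ∧ tsupport φ ⊆ Ω

/-! ### The operators -/

/-- The ellipticity, boundedness, homogeneity and monotonicity assumptions on `𝒜`; only the values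
`𝒜(x, q)` with `x ∈ closure G` matter. -/
structure IsElliptic {m : ℕ} (p : ℝ) (A : E m → E m → E m) : Prop where
  measurable : ∀ q, AEMeasurable (fun x => A x q) (volume.restrict (closure (G m)))
  continuous : ∀ᵐ x ∂(volume.restrict (closure (G m))), Continuous (A x)
  bounds : ∃ α₁ α₂ : ℝ, 0 < α₁ ∧ α₁ ≤ α₂ ∧
    (∀ q, ∀ᵐ x ∂(volume.restrict (closure (G m))), α₁ * ‖q‖ ^ p ≤ inner ℝ (A x q) q) ∧
    (∀ q, ∀ᵐ x ∂(volume.restrict (closure (G m))), ‖A x q‖ ≤ α₂ * ‖q‖ ^ (p - 1))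
  homogeneous : ∀ q, ∀ lam : ℝ, lam ≠ 0 → ∀ᵐ x ∂(volume.restrict (closure (G m))),
    A x (lam • q) = (lam * |lam| ^ (p - 2)) • A x q
  monotone : ∀ q₁ q₂, q₁ ≠ q₂ → ∀ᵐ x ∂(volume.restrict (closure (G m))),
    0 < inner ℝ (A x q₁ - A x q₂) (q₁ - q₂)

/-- `|J_T(x)|⁻¹ dT(x) 𝒜(x, dT(x)^* q)`. -/
def pushOp {m : ℕ} (κ : ℝ) (A : E m → E m → E m) (x q : E m) : E m :=
  |(fderiv ℝ (T κ) x).det|⁻¹ •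
    fderiv ℝ (T κ) x (A x (ContinuousLinearMap.adjoint (fderiv ℝ (T κ) x) q))

open Classical in
/-- The transformed operator `ℬ`, extended by reflection to the lower half-ball. -/
def opB {m : ℕ} (κ : ℝ) (A : E m → E m → E m) (ξ q : E m) : E m :=
  if ξ = 0 then 0
  else if 0 ≤ ht ξ then pushOp κ A (Tinv κ ξ) q
  else P (pushOp κ A (Tinv κ (P ξ)) (P q))

/-! ### Weak solutions -/

/-- `u ∈ W^{1,p}_loc(closure G ∖ F)` is a weak solution of `div 𝒜(x, ∇u) = 0` in `G ∖ F` with zero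
conormal derivative on `∂G ∖ F`. The space consists of the restrictions to `closure G ∖ F` of
functions `v ∈ W^{1,p}_loc(ℝⁿ ∖ F)`, and `g` is the gradient of `v`, so that `g = ∇u` in
`G ∖ F`. -/
def IsMixedWeakSol {m : ℕ} (p : ℝ) (A : E m → E m → E m) (F : Set (E m)) (u : E m → ℝ) : Prop :=
  ∃ (v : E m → ℝ) (g : E m → E m),
    u =ᵐ[volume.restrict (closure (G m) \ F)] v ∧
    IsSobolevGradLoc volume p Fᶜ v g ∧
    ∀ φ : E m → ℝ, IsTestFun Fᶜ φ →
      IntegrableOn (fun x => inner ℝ (A x (g x)) (gradient φ x)) (G m \ F) ∧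
      ∫ x in G m \ F, inner ℝ (A x (g x)) (gradient φ x) = 0

/-- `u ∈ H^{1,p}_loc(Ω, |ξ|^{p-n})` is a weak solution of `div ℬ(ξ, ∇u) = 0` in `Ω`. -/
def IsWeakSol {m : ℕ} (p : ℝ) (B : E m → E m → E m) (Ω : Set (E m)) (u : E m → ℝ) : Prop :=
  ∃ g : E m → E m, IsSobolevGradLoc (wMeasure m p) p Ω u g ∧
    ∀ φ : E m → ℝ, IsTestFun Ω φ →
      IntegrableOn (fun ξ => inner ℝ (B ξ (g ξ)) (gradient φ ξ)) Ω ∧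
      ∫ ξ in Ω, inner ℝ (B ξ (g ξ)) (gradient φ ξ) = 0

open Classical in
/-- The even reflection of `u ∘ T⁻¹`. In `D`, the points with `ξₙ ≥ 0` are those of
`T(closure G ∖ F)` and the points with `ξₙ < 0` are those of `PT(G ∖ F)`. -/
def reflect {m : ℕ} (κ : ℝ) (u : E m → ℝ) (ξ : E m) : ℝ :=
  if 0 ≤ ht ξ then u (Tinv κ ξ) else u (Tinv κ (P ξ))

end HalfCylinder

end

noncomputable section

namespace HalfCylinder

variable {m : ℕ}

/-! ### Coordinates -/

/-! `T` carries `G` onto the open upper half of the unit ball, the lateral boundary `|x'| = 1` into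
the hyperplane `ξₙ = 0`, the base into the unit sphere, and infinity to the origin. Gradients
transform by `dT*`, and `opB` is built so that the Jacobian cancels: the integral of `ℬ(ξ, q)·r`
over `T(S)` equals that of `𝒜(x, dT* q)·dT* r` over `S` (`setIntegral_pushOp`). Thus the problem
with zero conormal derivative becomes the equation in the upper half of `D`, tested with functions
that need not vanish on `ξₙ = 0`. Even reflection turns this natural boundary condition into the
equation across the hyperplane.

The weight is harmless: `0 ∉ D`, so it is bounded above and below on compact subsets of `D`
(`isSobolevGradLoc_wMeasure_iff`).

Reflection is composition with `unfold = T⁻¹ ∘ fold`, where `fold` is Lipschitz but not smooth. The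
chain rule `IsSobolevGrad.comp` therefore allows limits of smooth maps with bounded differentials;
here `|ξₙ|` is approximated by `√(ξₙ² + ε²)`.

For (a), a test function on `D` is pulled back by `T`, which shows that the upper half of the
integral vanishes by itself; applying this to `φ ∘ P` handles the lower half.

For (b), `ū ∘ T` is extended to the complement of `F` by a cutoff (`exists_extension`). The gradient
of an even function is even by uniqueness of weak gradients, so against an even test function the
two halves of the integral agree and both vanish. The even reflection of a test function on the
cylinder need not be smooth; it is approximated by smooth even functions (`exists_even_testFun`),
with dominated convergence supplied by the growth bound on `opB`. -/

theorem contDiff_hor : ContDiff ℝ ∞ (hor : E m → EuclideanSpace ℝ (Fin m)) := by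
  rw [contDiff_euclidean]
  intro i
  exact (EuclideanSpace.proj (𝕜 := ℝ) (ι := Fin (m + 1)) i.castSucc).contDiff

theorem contDiff_ht : ContDiff ℝ ∞ (ht : E m → ℝ) :=
  (EuclideanSpace.proj (𝕜 := ℝ) (ι := Fin (m + 1)) (Fin.last m)).contDiff

theorem contDiff_pt :
    ContDiff ℝ ∞ (fun z : EuclideanSpace ℝ (Fin m) × ℝ => pt z.1 z.2) := by
  rw [contDiff_euclidean]
  intro i
  refine Fin.lastCases ?_ (fun j => ?_) i
  · simpa [pt] using contDiff_snd
  · have h : ContDiff ℝ ∞ (fun z : EuclideanSpace ℝ (Fin m) × ℝ => z.1 j) :=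
      (EuclideanSpace.proj (𝕜 := ℝ) (ι := Fin m) j).contDiff.comp contDiff_fst
    simpa [pt] using h

@[fun_prop] theorem continuous_hor : Continuous (hor : E m → EuclideanSpace ℝ (Fin m)) :=
  contDiff_hor.continuous

@[fun_prop] theorem continuous_ht : Continuous (ht : E m → ℝ) := contDiff_ht.continuous

theorem continuous_pt : Continuous (fun z : EuclideanSpace ℝ (Fin m) × ℝ => pt z.1 z.2) :=
  contDiff_pt.continuous

theorem ext_hor_ht {x y : E m} (h : hor x = hor y) (h' : ht x = ht y) : x = y := by
  rw [← pt_hor_ht x, ← pt_hor_ht y, h, h']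

theorem dist_sq_eq (x y : E m) :
    dist x y ^ 2 = dist (hor x) (hor y) ^ 2 + (ht x - ht y) ^ 2 := by
  rw [dist_eq_norm, norm_sq_eq, dist_eq_norm]
  rfl

theorem hor_add (x y : E m) : hor (x + y) = hor x + hor y := rfl
theorem ht_add (x y : E m) : ht (x + y) = ht x + ht y := rfl
theorem hor_smul (c : ℝ) (x : E m) : hor (c • x) = c • hor x := rfl
theorem ht_smul (c : ℝ) (x : E m) : ht (c • x) = c * ht x := rfl

/-! ### The reflection -/

@[simp] theorem hor_P (ξ : E m) : hor (P ξ) = hor ξ := by simp [P]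
@[simp] theorem ht_P (ξ : E m) : ht (P ξ) = -ht ξ := by simp [P]
@[simp] theorem P_P (ξ : E m) : P (P ξ) = ξ := by simp [P]

theorem norm_P (ξ : E m) : ‖P ξ‖ = ‖ξ‖ := by
  rw [← sq_eq_sq₀ (norm_nonneg _) (norm_nonneg _), norm_sq_eq, norm_sq_eq]
  simp

/-- The reflection as a linear isometry. -/
def reflection (m : ℕ) : E m ≃ₗᵢ[ℝ] E m where
  toFun := P
  invFun := P
  left_inv := P_P
  right_inv := P_P
  map_add' x y := ext_hor_ht (by simp [hor_add]) (by simp [ht_add]; ring)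
  map_smul' c x := ext_hor_ht (by simp [hor_smul]) (by simp [ht_smul])
  norm_map' := norm_P

@[simp] theorem coe_reflection : ⇑(reflection m) = P := rfl

@[fun_prop] theorem continuous_P : Continuous (P : E m → E m) := (reflection m).continuous

theorem measurePreserving_P : MeasurePreserving (P : E m → E m) volume volume :=
  (reflection m).measurePreserving

theorem measurableEmbedding_P : MeasurableEmbedding (P : E m → E m) :=
  (reflection m).toHomeomorph.measurableEmbedding

theorem inner_P_left (x y : E m) : inner ℝ (P x) y = inner ℝ x (P y) := by
  have := (reflection m).inner_map_map x (P y)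
  simpa using this

theorem inner_P_P (x y : E m) : inner ℝ (P x) (P y) = inner ℝ x y :=
  (reflection m).inner_map_map x y

theorem hasFDerivAt_P (x : E m) :
    HasFDerivAt P ((reflection m).toContinuousLinearEquiv : E m →L[ℝ] E m) x :=
  ((reflection m).toContinuousLinearEquiv : E m →L[ℝ] E m).hasFDerivAt

theorem contDiff_P : ContDiff ℝ ∞ (P : E m → E m) :=
  ((reflection m).toContinuousLinearEquiv : E m →L[ℝ] E m).contDiff

theorem adjoint_fderiv_P (x q : E m) :
    ContinuousLinearMap.adjoint (fderiv ℝ P x) q = P q := by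
  rw [(hasFDerivAt_P x).fderiv]
  refine ext_inner_right ℝ fun y => ?_
  rw [ContinuousLinearMap.adjoint_inner_left]
  exact (inner_P_left q y).symm

/-! ### Folding onto the upper half-space -/

/-- The fold `(ξ', ξₙ) ↦ (ξ', |ξₙ|)`. -/
def fold (ξ : E m) : E m := pt (hor ξ) |ht ξ|

/-- The smooth approximation `(ξ', ξₙ) ↦ (ξ', √(ξₙ² + ε²))` of the fold. -/
def foldEps (ε : ℝ) (ξ : E m) : E m := pt (hor ξ) (√(ht ξ ^ 2 + ε ^ 2))

@[simp] theorem hor_fold (ξ : E m) : hor (fold ξ) = hor ξ := by simp [fold]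
@[simp] theorem ht_fold (ξ : E m) : ht (fold ξ) = |ht ξ| := by simp [fold]
@[simp] theorem hor_foldEps (ε : ℝ) (ξ : E m) : hor (foldEps ε ξ) = hor ξ := by simp [foldEps]
@[simp] theorem ht_foldEps (ε : ℝ) (ξ : E m) : ht (foldEps ε ξ) = √(ht ξ ^ 2 + ε ^ 2) := by
  simp [foldEps]

theorem fold_of_nonneg {ξ : E m} (h : 0 ≤ ht ξ) : fold ξ = ξ :=
  ext_hor_ht (by simp) (by simp [abs_of_nonneg h])

theorem fold_of_nonpos {ξ : E m} (h : ht ξ ≤ 0) : fold ξ = P ξ :=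
  ext_hor_ht (by simp) (by simp [abs_of_nonpos h])

@[simp] theorem fold_P (ξ : E m) : fold (P ξ) = fold ξ := ext_hor_ht (by simp) (by simp)

@[simp] theorem foldEps_P (ε : ℝ) (ξ : E m) : foldEps ε (P ξ) = foldEps ε ξ :=
  ext_hor_ht (by simp) (by simp)

@[simp] theorem norm_fold (ξ : E m) : ‖fold ξ‖ = ‖ξ‖ := by
  rw [← sq_eq_sq₀ (norm_nonneg _) (norm_nonneg _), norm_sq_eq, norm_sq_eq]
  simp

@[fun_prop] theorem continuous_fold : Continuous (fold : E m → E m) :=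
  continuous_pt.comp (continuous_hor.prodMk continuous_ht.abs)

theorem contDiff_foldEps {ε : ℝ} (hε : 0 < ε) : ContDiff ℝ ∞ (foldEps ε : E m → E m) := by
  have h : ContDiff ℝ ∞ (fun ξ : E m => √(ht ξ ^ 2 + ε ^ 2)) :=
    ((contDiff_ht.pow 2).add contDiff_const).sqrt (fun x => by positivity)
  exact contDiff_pt.comp (contDiff_hor.prodMk h)

theorem ht_foldEps_pos {ε : ℝ} (hε : 0 < ε) (ξ : E m) : 0 < ht (foldEps ε ξ) := by
  rw [ht_foldEps]; positivity

/-- The error is uniform in `ξ`, so the approximants send a compact set into a fixed closed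
neighbourhood of its fold. -/
theorem dist_foldEps_fold {ε : ℝ} (hε : 0 < ε) (ξ : E m) : dist (foldEps ε ξ) (fold ξ) ≤ ε := by
  rw [← sq_le_sq₀ dist_nonneg hε.le, dist_sq_eq]
  have h1 : |ht ξ| ≤ √(ht ξ ^ 2 + ε ^ 2) := Real.abs_le_sqrt (by nlinarith)
  have h2 : √(ht ξ ^ 2 + ε ^ 2) ≤ |ht ξ| + ε := by
    rw [Real.sqrt_le_left (by positivity)]
    nlinarith [sq_abs (ht ξ), abs_nonneg (ht ξ)]
  simp only [hor_foldEps, hor_fold, dist_self, ht_foldEps, ht_fold]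
  nlinarith

theorem tendsto_foldEps {e : ℕ → ℝ} (he : ∀ k, 0 < e k) (he' : Tendsto e atTop (𝓝 0)) (ξ : E m) :
    Tendsto (fun k => foldEps (e k) ξ) atTop (𝓝 (fold ξ)) := by
  rw [tendsto_iff_dist_tendsto_zero]
  exact squeeze_zero (fun _ => dist_nonneg) (fun k => dist_foldEps_fold (he k) ξ) he'

/-! ### The change of variables -/

theorem contDiff_T (κ : ℝ) : ContDiff ℝ ∞ (T κ : E m → E m) := by
  have h0 : ContDiff ℝ ∞ (fun x : E m => 1 + ‖hor x‖ ^ 2) :=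
    contDiff_const.add (contDiff_hor.norm_sq ℝ)
  have h1 : ∀ x : E m, 1 + ‖hor x‖ ^ 2 ≠ 0 := fun x => by positivity
  have h2 : ContDiff ℝ ∞ (fun x : E m => Real.exp (-κ * ht x)) :=
    (contDiff_const.mul contDiff_ht).exp
  have h3 : ContDiff ℝ ∞ (fun x : E m =>
      (2 * Real.exp (-κ * ht x) / (1 + ‖hor x‖ ^ 2)) • hor x) :=
    ((contDiff_const.mul h2).div h0 h1).smul contDiff_hor
  have h4 : ContDiff ℝ ∞ (fun x : E m =>
      Real.exp (-κ * ht x) * (1 - ‖hor x‖ ^ 2) / (1 + ‖hor x‖ ^ 2)) :=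
    (h2.mul (contDiff_const.sub (contDiff_hor.norm_sq ℝ))).div h0 h1
  exact contDiff_pt.comp (h3.prodMk h4)

@[fun_prop] theorem continuous_T (κ : ℝ) : Continuous (T κ : E m → E m) := (contDiff_T κ).continuous

theorem T_injective {κ : ℝ} (hκ : 0 < κ) : Function.Injective (T κ : E m → E m) :=
  Function.LeftInverse.injective (Tinv_T hκ)

/-- The complement of the closed half-line `{ξ' = 0, ξₙ ≤ 0}`. -/
def slit (m : ℕ) : Set (E m) := {ξ | 0 < ‖ξ‖ + ht ξ}

theorem isOpen_slit : IsOpen (slit m) :=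
  isOpen_lt continuous_const (continuous_norm.add continuous_ht)

theorem ne_zero_of_mem_slit {ξ : E m} (h : ξ ∈ slit m) : ξ ≠ 0 := by
  rintro rfl
  simp [slit, ht] at h

theorem mem_slit_of_nonneg {ξ : E m} (h : 0 ≤ ht ξ) (h0 : ξ ≠ 0) : ξ ∈ slit m := by
  have := norm_pos_iff.2 h0
  simp only [slit, Set.mem_ofPred_eq]; linarith

theorem mem_slit_fold {ξ : E m} (h0 : ξ ≠ 0) : fold ξ ∈ slit m :=
  mem_slit_of_nonneg (by simp) (by rw [← norm_pos_iff, norm_fold]; exact norm_pos_iff.2 h0)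

theorem T_Tinv_slit {κ : ℝ} (hκ : 0 < κ) {ξ : E m} (h : ξ ∈ slit m) : T κ (Tinv κ ξ) = ξ := by
  refine T_Tinv hκ ξ fun ⟨h1, h2⟩ => ?_
  have h3 := norm_sq_eq ξ
  rw [h1] at h3
  have h4 : ‖ξ‖ = |ht ξ| := by
    rw [← sq_eq_sq₀ (norm_nonneg _) (abs_nonneg _), h3]; simp
  rw [abs_of_nonpos h2] at h4
  simp [slit, h4] at h

theorem T_ne_zero (κ : ℝ) (x : E m) : T κ x ≠ 0 := by
  rw [← norm_pos_iff, norm_T]; positivity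

theorem T_mem_slit (κ : ℝ) (x : E m) : T κ x ∈ slit m := by
  have h1 : (0 : ℝ) < 1 + ‖hor x‖ ^ 2 := by positivity
  have h2 := Real.exp_pos (-κ * ht x)
  simp only [slit, Set.mem_ofPred_eq, norm_T]
  simp only [T, ht_pt]
  have : Real.exp (-κ * ht x) + Real.exp (-κ * ht x) * (1 - ‖hor x‖ ^ 2) / (1 + ‖hor x‖ ^ 2) =
      2 * Real.exp (-κ * ht x) / (1 + ‖hor x‖ ^ 2) := by
    field_simp; ring
  rw [this]; positivity

theorem contDiffOn_Tinv (κ : ℝ) : ContDiffOn ℝ ∞ (Tinv κ : E m → E m) (slit m) := by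
  have h0 : ContDiffOn ℝ ∞ (fun ξ : E m => ‖ξ‖) (slit m) := fun ξ h =>
    (contDiffAt_norm ℝ (ne_zero_of_mem_slit h)).contDiffWithinAt
  have h1 : ContDiffOn ℝ ∞ (fun ξ : E m => (‖ξ‖ + ht ξ)⁻¹ • hor ξ) (slit m) :=
    ((h0.add contDiff_ht.contDiffOn).inv (fun ξ h => ne_of_gt h)).smul contDiff_hor.contDiffOn
  have h2 : ContDiffOn ℝ ∞ (fun ξ : E m => -(1 / κ) * Real.log ‖ξ‖) (slit m) :=
    contDiffOn_const.mul (h0.log (fun ξ h => (norm_pos_iff.2 (ne_zero_of_mem_slit h)).ne'))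
  exact contDiff_pt.comp_contDiffOn (h1.prodMk h2)

theorem contDiffAt_Tinv (κ : ℝ) {ξ : E m} (h : ξ ∈ slit m) : ContDiffAt ℝ ∞ (Tinv κ) ξ :=
  (contDiffOn_Tinv κ).contDiffAt (isOpen_slit.mem_nhds h)

theorem measurable_Tinv (κ : ℝ) : Measurable (Tinv κ : E m → E m) := by
  refine continuous_pt.measurable.comp (Measurable.prodMk ?_ ?_)
  · exact ((measurable_norm.add continuous_ht.measurable).inv).smul continuous_hor.measurable
  · exact (Real.measurable_log.comp measurable_norm).const_mul _

theorem differentiableAt_T (κ : ℝ) (x : E m) : DifferentiableAt ℝ (T κ) x :=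
  (contDiff_T κ).differentiable (by simp) x

theorem differentiableAt_Tinv (κ : ℝ) {ξ : E m} (h : ξ ∈ slit m) :
    DifferentiableAt ℝ (Tinv κ) ξ :=
  (contDiffAt_Tinv κ h).differentiableAt (by simp)

theorem fderiv_Tinv_comp_fderiv_T {κ : ℝ} (hκ : 0 < κ) (x : E m) :
    (fderiv ℝ (Tinv κ) (T κ x)).comp (fderiv ℝ (T κ) x) = ContinuousLinearMap.id ℝ (E m) := by
  rw [← fderiv_comp x (differentiableAt_Tinv κ (T_mem_slit κ x)) (differentiableAt_T κ x)]
  have : Tinv κ ∘ T κ = (id : E m → E m) := funext (Tinv_T hκ)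
  rw [this, fderiv_id]

/-- The differential of `Tinv` is a left inverse of that of `T`, and determinants multiply. -/
theorem det_fderiv_T_ne_zero {κ : ℝ} (hκ : 0 < κ) (x : E m) : (fderiv ℝ (T κ) x).det ≠ 0 := by
  intro h
  have h1 := congrArg ContinuousLinearMap.det (fderiv_Tinv_comp_fderiv_T hκ x)
  have h2 : ((fderiv ℝ (Tinv κ) (T κ x)).comp (fderiv ℝ (T κ) x)).det =
      (fderiv ℝ (Tinv κ) (T κ x)).det * (fderiv ℝ (T κ) x).det := by
    simp [ContinuousLinearMap.det, LinearMap.det_comp]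
  rw [h2, h] at h1
  simp [ContinuousLinearMap.det] at h1

theorem continuous_fderiv_T (κ : ℝ) : Continuous (fderiv ℝ (T κ : E m → E m)) :=
  (contDiff_T κ).continuous_fderiv (by simp)

theorem continuous_det_fderiv_T (κ : ℝ) :
    Continuous (fun x : E m => |(fderiv ℝ (T κ) x).det|) :=
  (ContinuousLinearMap.continuous_det.comp (continuous_fderiv_T κ)).abs

/-- The last coordinate of `T x` has the sign of `1 - ‖hor x‖²`: the hyperplane corresponds to the
lateral surface of the cylinder. -/
theorem ht_T_pos_iff (κ : ℝ) (x : E m) : 0 < ht (T κ x) ↔ ‖hor x‖ < 1 := by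
  have h1 : (0 : ℝ) < 1 + ‖hor x‖ ^ 2 := by positivity
  simp only [T, ht_pt]
  rw [div_pos_iff_of_pos_right h1, mul_pos_iff_of_pos_left (Real.exp_pos _), sub_pos,
    sq_lt_one_iff₀ (norm_nonneg _)]

theorem ht_T_nonneg_iff (κ : ℝ) (x : E m) : 0 ≤ ht (T κ x) ↔ ‖hor x‖ ≤ 1 := by
  have h1 : (0 : ℝ) < 1 + ‖hor x‖ ^ 2 := by positivity
  simp only [T, ht_pt]
  rw [le_div_iff₀ h1, zero_mul, mul_nonneg_iff_of_pos_left (Real.exp_pos _), sub_nonneg,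
    sq_le_one_iff₀ (norm_nonneg _)]

theorem norm_T_lt_one_iff {κ : ℝ} (hκ : 0 < κ) (x : E m) : ‖T κ x‖ < 1 ↔ 0 < ht x := by
  rw [norm_T, Real.exp_lt_one_iff]
  constructor
  · intro h; by_contra hc; nlinarith
  · intro h; nlinarith

/-! ### The domains -/

/-- The closed half-cylinder. -/
def closedCyl (m : ℕ) : Set (E m) := {x | ‖hor x‖ ≤ 1 ∧ 0 ≤ ht x}

theorem isClosed_closedCyl : IsClosed (closedCyl m) :=
  (isClosed_le continuous_hor.norm continuous_const).inter
    (isClosed_le continuous_const continuous_ht)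

theorem isOpen_G : IsOpen (G m) :=
  (isOpen_lt continuous_hor.norm continuous_const).inter
    (isOpen_lt continuous_const continuous_ht)

theorem G_subset_closedCyl : G m ⊆ closedCyl m := fun _ h => ⟨h.1.le, h.2.le⟩

theorem closure_G_subset : closure (G m) ⊆ closedCyl m :=
  closure_minimal G_subset_closedCyl isClosed_closedCyl

/-- A closed set containing the open base also contains its rim `‖hor x‖ = 1`. Hence points of the
closed cylinder outside `F` have positive height, and `T` sends them inside the open unit ball. -/
theorem mem_of_base_subset {F : Set (E m)} (hF : IsClosed F) (hb : base m ⊆ F) {x : E m}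
    (h1 : ‖hor x‖ ≤ 1) (h2 : ht x = 0) : x ∈ F := by
  have h3 : hor x ∈ closure (Metric.ball (0 : EuclideanSpace ℝ (Fin m)) 1) := by
    rw [closure_ball _ one_ne_zero]; simpa using h1
  have h4 : pt (hor x) 0 ∈ closure (base m) := by
    refine map_mem_closure (f := fun y => pt y 0) ?_ h3 ?_
    · exact continuous_pt.comp (continuous_id.prodMk continuous_const)
    · intro y hy
      exact ⟨by simpa using hy, by simp⟩
  rw [← pt_hor_ht x, h2]
  exact hF.closure_subset_iff.2 hb h4

/-- The map `T⁻¹ ∘ fold`, with which `reflect κ u = u ∘ unfold κ`. -/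
def unfold (κ : ℝ) (ξ : E m) : E m := Tinv κ (fold ξ)

theorem reflect_eq (κ : ℝ) (u : E m → ℝ) (ξ : E m) : reflect κ u ξ = u (unfold κ ξ) := by
  unfold reflect unfold
  split_ifs with h
  · rw [fold_of_nonneg h]
  · rw [fold_of_nonpos (not_le.1 h).le]

theorem T_unfold {κ : ℝ} (hκ : 0 < κ) {ξ : E m} (h : ξ ≠ 0) : T κ (unfold κ ξ) = fold ξ :=
  T_Tinv_slit hκ (mem_slit_fold h)

theorem unfold_T {κ : ℝ} (hκ : 0 < κ) {x : E m} (h : ‖hor x‖ ≤ 1) : unfold κ (T κ x) = x := by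
  rw [unfold, fold_of_nonneg ((ht_T_nonneg_iff κ x).2 h), Tinv_T hκ]

@[simp] theorem unfold_P (κ : ℝ) (ξ : E m) : unfold κ (P ξ) = unfold κ ξ := by
  simp [unfold]

theorem continuousOn_unfold (κ : ℝ) : ContinuousOn (unfold κ : E m → E m) {0}ᶜ :=
  (contDiffOn_Tinv κ).continuousOn.comp continuous_fold.continuousOn fun _ h => mem_slit_fold h

theorem measurable_unfold (κ : ℝ) : Measurable (unfold κ : E m → E m) :=
  (measurable_Tinv κ).comp continuous_fold.measurable

theorem norm_hor_unfold_le {κ : ℝ} (hκ : 0 < κ) {ξ : E m} (h : ξ ≠ 0) :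
    ‖hor (unfold κ ξ)‖ ≤ 1 := by
  rw [← ht_T_nonneg_iff κ, T_unfold hκ h]; simp

/-- Since `F` lies in the closed cylinder, `T(F)` lies in `ξₙ ≥ 0`, and `unfold` detects `T(F)` and
its mirror image at once. In this form the openness of `D` and its invariance under `P` are
immediate. -/
theorem mem_D_iff {κ : ℝ} (hκ : 0 < κ) {F : Set (E m)} (hFG : F ⊆ closure (G m)) (ξ : E m) :
    ξ ∈ D κ F ↔ ξ ≠ 0 ∧ ‖ξ‖ < 1 ∧ unfold κ ξ ∉ F := by
  have hF1 : ∀ x ∈ F, ‖hor x‖ ≤ 1 := fun x hx => (closure_G_subset (hFG hx)).1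
  simp only [D, Ftilde, Set.mem_sdiff, Metric.mem_ball, dist_zero_right, Set.mem_union,
    Set.mem_singleton_iff, not_or]
  constructor
  · rintro ⟨h1, ⟨h2, h3⟩, h4⟩
    refine ⟨h4, h1, fun h5 => ?_⟩
    rcases le_total 0 (ht ξ) with h | h
    · exact h2 ⟨_, h5, by rw [T_unfold hκ h4, fold_of_nonneg h]⟩
    · exact h3 ⟨P ξ, ⟨_, h5, by rw [T_unfold hκ h4, fold_of_nonpos h]⟩, P_P ξ⟩
  · rintro ⟨h1, h2, h3⟩
    refine ⟨h2, ⟨?_, ?_⟩, h1⟩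
    · rintro ⟨x, hx, rfl⟩
      rw [unfold_T hκ (hF1 x hx)] at h3
      exact h3 hx
    · rintro ⟨_, ⟨x, hx, rfl⟩, rfl⟩
      rw [unfold_P, unfold_T hκ (hF1 x hx)] at h3
      exact h3 hx

section Domain

variable {κ : ℝ} (hκ : 0 < κ) {F : Set (E m)} (hF : IsClosed F) (hFG : F ⊆ closure (G m))
  (hb : base m ⊆ F)

include hκ hFG

include hF in
theorem isOpen_D : IsOpen (D κ F) := by
  have h : D κ F = Metric.ball 0 1 ∩ ({0}ᶜ ∩ unfold κ ⁻¹' Fᶜ) := by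
    ext ξ
    rw [mem_D_iff hκ hFG]
    simp only [Set.mem_inter_iff, Metric.mem_ball, dist_zero_right, Set.mem_compl_iff,
      Set.mem_singleton_iff, Set.mem_preimage]
    tauto
  rw [h]
  exact Metric.isOpen_ball.inter
    ((continuousOn_unfold κ).isOpen_inter_preimage isOpen_compl_singleton hF.isOpen_compl)

theorem P_mem_D {ξ : E m} : P ξ ∈ D κ F ↔ ξ ∈ D κ F := by
  have h : P ξ ≠ 0 ↔ ξ ≠ 0 := by rw [← norm_pos_iff, norm_P, norm_pos_iff]
  rw [mem_D_iff hκ hFG, mem_D_iff hκ hFG, unfold_P, norm_P, h]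

theorem fold_mem_D {ξ : E m} : fold ξ ∈ D κ F ↔ ξ ∈ D κ F := by
  rcases le_total 0 (ht ξ) with h | h
  · rw [fold_of_nonneg h]
  · rw [fold_of_nonpos h, P_mem_D hκ hFG]

theorem ne_zero_of_mem_D {ξ : E m} (h : ξ ∈ D κ F) : ξ ≠ 0 := ((mem_D_iff hκ hFG ξ).1 h).1

theorem ht_pos_of_T_mem_D {x : E m} (h : T κ x ∈ D κ F) : 0 < ht x :=
  (norm_T_lt_one_iff hκ x).1 ((mem_D_iff hκ hFG _).1 h).2.1

theorem notMem_of_T_mem_D {x : E m} (h : T κ x ∈ D κ F) : x ∉ F := fun hx => by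
  have h1 := ((mem_D_iff hκ hFG _).1 h).2.2
  rw [unfold_T hκ (closure_G_subset (hFG hx)).1] at h1
  exact h1 hx

include hF hb in
theorem T_mem_D {x : E m} (h : x ∈ closedCyl m) (hx : x ∉ F) : T κ x ∈ D κ F := by
  rw [mem_D_iff hκ hFG, unfold_T hκ h.1, norm_T_lt_one_iff hκ]
  refine ⟨T_ne_zero κ x, lt_of_le_of_ne h.2 fun h0 => hx ?_, hx⟩
  exact mem_of_base_subset hF hb h.1 h0.symm

theorem unfold_mem {ξ : E m} (h : ξ ∈ D κ F) : unfold κ ξ ∈ closedCyl m \ F := by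
  have h0 := ne_zero_of_mem_D hκ hFG h
  have h1 : T κ (unfold κ ξ) ∈ D κ F := by rwa [T_unfold hκ h0, fold_mem_D hκ hFG]
  exact ⟨⟨norm_hor_unfold_le hκ h0, (ht_pos_of_T_mem_D hκ hFG h1).le⟩,
    notMem_of_T_mem_D hκ hFG h1⟩

include hF hb in
theorem T_image_G_diff : T κ '' (G m \ F) = D κ F ∩ {ξ | 0 < ht ξ} := by
  ext ξ
  constructor
  · rintro ⟨x, ⟨h1, h2⟩, rfl⟩
    exact ⟨T_mem_D hκ hF hFG hb (G_subset_closedCyl h1) h2, (ht_T_pos_iff κ x).2 h1.1⟩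
  · rintro ⟨h1, h2⟩
    have h0 := ne_zero_of_mem_D hκ hFG h1
    have h3 : T κ (unfold κ ξ) = ξ := by
      rw [T_unfold hκ h0, fold_of_nonneg (le_of_lt h2)]
    rw [← h3] at h1 h2
    exact ⟨_, ⟨⟨(ht_T_pos_iff κ _).1 h2, ht_pos_of_T_mem_D hκ hFG h1⟩,
      notMem_of_T_mem_D hκ hFG h1⟩, h3⟩

end Domain

theorem volume_ht_eq_zero : volume {ξ : E m | ht ξ = 0} = 0 := by
  let s : Submodule ℝ (E m) :=
    LinearMap.ker (EuclideanSpace.proj (𝕜 := ℝ) (ι := Fin (m + 1))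
      (Fin.last m)).toLinearMap
  have h : {ξ : E m | ht ξ = 0} = s := rfl
  rw [h]
  refine Measure.addHaar_submodule _ _ fun h1 => ?_
  have h2 : pt (0 : EuclideanSpace ℝ (Fin m)) 1 ∈ s := h1 ▸ Submodule.mem_top
  have h3 : ht (pt (0 : EuclideanSpace ℝ (Fin m)) 1) = 0 := h2
  simp at h3

/-! ### Gradients -/

theorem inner_gradient (f : E m → ℝ) (x y : E m) : inner ℝ (gradient f x) y = fderiv ℝ f x y := by
  rw [gradient, InnerProductSpace.toDual_symm_apply]

theorem norm_gradient (f : E m → ℝ) (x : E m) : ‖gradient f x‖ = ‖fderiv ℝ f x‖ := by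
  rw [gradient, LinearIsometryEquiv.norm_map]

theorem gradient_comp {f : E m → ℝ} {τ : E m → E m} {x : E m} (hf : DifferentiableAt ℝ f (τ x))
    (hτ : DifferentiableAt ℝ τ x) :
    gradient (fun y => f (τ y)) x =
      ContinuousLinearMap.adjoint (fderiv ℝ τ x) (gradient f (τ x)) := by
  refine ext_inner_right ℝ fun y => ?_
  rw [ContinuousLinearMap.adjoint_inner_left, inner_gradient, inner_gradient]
  have := fderiv_comp x hf hτ
  rw [Function.comp_def] at this
  rw [this]; rfl

theorem gradient_mul {f χ : E m → ℝ} {x : E m} (hχ : DifferentiableAt ℝ χ x)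
    (hf : DifferentiableAt ℝ f x) :
    gradient (fun y => χ y * f y) x = χ x • gradient f x + f x • gradient χ x := by
  refine ext_inner_right ℝ fun y => ?_
  rw [inner_add_left, real_inner_smul_left, real_inner_smul_left, inner_gradient, inner_gradient,
    inner_gradient, fderiv_fun_mul hχ hf]
  simp

theorem continuousOn_gradient {f : E m → ℝ} {U : Set (E m)} (hU : IsOpen U)
    (hf : ContDiffOn ℝ ∞ f U) : ContinuousOn (gradient f) U :=
  (InnerProductSpace.toDual ℝ (E m)).symm.continuous.comp_continuousOn
    (hf.continuousOn_fderiv_of_isOpen hU (by simp))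

theorem continuous_gradient {f : E m → ℝ} (hf : ContDiff ℝ ∞ f) : Continuous (gradient f) :=
  (InnerProductSpace.toDual ℝ (E m)).symm.continuous.comp (hf.continuous_fderiv (by simp))

theorem support_gradient_subset (f : E m → ℝ) : Function.support (gradient f) ⊆ tsupport f := by
  intro x hx
  refine support_fderiv_subset ℝ (f := f) ?_
  rw [Function.mem_support] at hx ⊢
  rw [← norm_ne_zero_iff] at hx ⊢
  rwa [norm_gradient] at hx

theorem gradient_congr {f g : E m → ℝ} {x : E m} (h : f =ᶠ[𝓝 x] g) :
    gradient f x = gradient g x := by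
  rw [gradient, gradient, h.fderiv_eq]

/-! ### Bounded convergence in `L^p` -/

section Bounded

variable {X H : Type*} [MeasurableSpace X] {μ : Measure X} [IsFiniteMeasure μ]
  [NormedAddCommGroup H] {f : ℕ → X → H} {g : X → H} {C p : ℝ}

theorem tendsto_eLpNorm_of_bounded (hp : 0 < p) (hf : ∀ k, AEStronglyMeasurable (f k) μ)
    (hC : ∀ k, ∀ᵐ x ∂μ, ‖f k x‖ ≤ C)
    (hlim : ∀ᵐ x ∂μ, Tendsto (fun k => f k x) atTop (𝓝 (g x))) :
    Tendsto (fun k => eLpNorm (fun x => f k x - g x) (ENNReal.ofReal p) μ) atTop (𝓝 0) := by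
  have hg := aestronglyMeasurable_of_tendsto_ae atTop hf hlim
  have h0 : ENNReal.ofReal p ≠ 0 := by simpa using hp
  have h1 : Tendsto (fun k => ∫⁻ x, ‖f k x - g x‖ₑ ^ p ∂μ) atTop (𝓝 (∫⁻ _, 0 ∂μ)) := by
    refine tendsto_lintegral_of_dominated_convergence' (fun _ => ENNReal.ofReal (C + C) ^ p)
      (fun k => ((hf k).sub hg).enorm.pow_const p) (fun k => ?_) ?_ ?_
    · filter_upwards [hlim, ae_all_iff.2 hC] with x h1 h2
      have h3 : ‖g x‖ ≤ C := le_of_tendsto h1.norm (Eventually.of_forall h2)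
      have h4 : ‖f k x - g x‖ ≤ C + C := (norm_sub_le _ _).trans (add_le_add (h2 k) h3)
      refine ENNReal.rpow_le_rpow ?_ hp.le
      rw [← ofReal_norm]
      exact ENNReal.ofReal_le_ofReal h4
    · rw [lintegral_const]
      exact ENNReal.mul_ne_top (ENNReal.rpow_ne_top_of_nonneg hp.le ENNReal.ofReal_ne_top)
        (measure_ne_top _ _)
    · filter_upwards [hlim] with x h1
      have h2 : Tendsto (fun k => ‖f k x - g x‖ₑ) atTop (𝓝 0) := by
        have h3 := (h1.sub_const (g x)).enorm
        simpa using h3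
      have h3 := (ENNReal.continuous_rpow_const (y := p)).tendsto 0 |>.comp h2
      simpa [ENNReal.zero_rpow_of_pos hp, Function.comp_def] using h3
  simp only [lintegral_zero] at h1
  simp only [eLpNorm_eq_lintegral_rpow_enorm_toReal h0 ENNReal.ofReal_ne_top,
    ENNReal.toReal_ofReal hp.le]
  have h2 := (ENNReal.continuous_rpow_const (y := 1 / p)).tendsto 0 |>.comp h1
  simpa [ENNReal.zero_rpow_of_pos (inv_pos.2 hp), Function.comp_def] using h2

end Bounded

/-! ### Sobolev functions -/

section Sobolev

variable {μ ν : Measure (E m)} {p : ℝ} {V W : Set (E m)} {u v : E m → ℝ} {g h : E m → E m}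

theorem IsSobolevGrad.exists_approx (hu : IsSobolevGrad μ p V u g) {ε : ℝ≥0∞} (hε : ε ≠ 0) :
    ∃ φ : E m → ℝ, ContDiffOn ℝ ∞ φ V ∧ MemLp φ (ENNReal.ofReal p) (μ.restrict V) ∧
      MemLp (gradient φ) (ENNReal.ofReal p) (μ.restrict V) ∧
      eLpNorm (fun x => φ x - u x) (ENNReal.ofReal p) (μ.restrict V) ≤ ε ∧
      eLpNorm (fun x => gradient φ x - g x) (ENNReal.ofReal p) (μ.restrict V) ≤ ε := by
  obtain ⟨-, -, φ, h1, h2, h3⟩ := hu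
  have h4 := (h2.eventually (ge_mem_nhds (pos_iff_ne_zero.2 hε))).and
    (h3.eventually (ge_mem_nhds (pos_iff_ne_zero.2 hε)))
  obtain ⟨k, hk⟩ := h4.exists
  exact ⟨φ k, (h1 k).1, (h1 k).2.1, (h1 k).2.2, hk.1, hk.2⟩

theorem IsSobolevGrad.of_approx (hu : MemLp u (ENNReal.ofReal p) (μ.restrict V))
    (hg : MemLp g (ENNReal.ofReal p) (μ.restrict V))
    (H : ∀ ε : ℝ≥0∞, ε ≠ 0 → ∃ φ : E m → ℝ, ContDiffOn ℝ ∞ φ V ∧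
      MemLp φ (ENNReal.ofReal p) (μ.restrict V) ∧
      MemLp (gradient φ) (ENNReal.ofReal p) (μ.restrict V) ∧
      eLpNorm (fun x => φ x - u x) (ENNReal.ofReal p) (μ.restrict V) ≤ ε ∧
      eLpNorm (fun x => gradient φ x - g x) (ENNReal.ofReal p) (μ.restrict V) ≤ ε) :
    IsSobolevGrad μ p V u g := by
  choose φ h1 h2 h3 h4 h5 using fun k : ℕ => H ((k : ℝ≥0∞)⁻¹) (by simp)
  have h6 := ENNReal.tendsto_inv_nat_nhds_zero
  exact ⟨hu, hg, φ, fun k => ⟨h1 k, h2 k, h3 k⟩,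
    tendsto_of_tendsto_of_tendsto_of_le_of_le tendsto_const_nhds h6 (fun _ => zero_le) h4,
    tendsto_of_tendsto_of_tendsto_of_le_of_le tendsto_const_nhds h6 (fun _ => zero_le) h5⟩

theorem eLpNorm_le_of_measure_le {X H : Type*} [MeasurableSpace X] [NormedAddCommGroup H]
    {μ ν : Measure X} {c : ℝ≥0∞} (h : μ ≤ c • ν) (f : X → H) {q : ℝ≥0∞} (hq : q ≠ ⊤) :
    eLpNorm f q μ ≤ c ^ (1 / q).toReal * eLpNorm f q ν :=
  (eLpNorm_mono_measure f h).trans_eq (eLpNorm_smul_measure_of_ne_top hq f c)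

theorem IsSobolevGrad.mono_measure (hu : IsSobolevGrad ν p W u g) (hVW : V ⊆ W) {c : ℝ≥0∞}
    (hc : c ≠ ⊤) (hle : μ.restrict V ≤ c • ν.restrict W) : IsSobolevGrad μ p V u g := by
  obtain ⟨h0, h0', φ, h1, h2, h3⟩ := hu
  have hc' : c ^ (1 / ENNReal.ofReal p).toReal ≠ ⊤ :=
    ENNReal.rpow_ne_top_of_nonneg ENNReal.toReal_nonneg hc
  refine ⟨h0.of_measure_le_smul hc hle, h0'.of_measure_le_smul hc hle, φ, fun k =>
    ⟨(h1 k).1.mono hVW, (h1 k).2.1.of_measure_le_smul hc hle,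
      (h1 k).2.2.of_measure_le_smul hc hle⟩, ?_, ?_⟩
  · refine tendsto_of_tendsto_of_tendsto_of_le_of_le tendsto_const_nhds
      (by simpa using ENNReal.Tendsto.const_mul h2 (Or.inr hc')) (fun _ => zero_le)
      (fun k => eLpNorm_le_of_measure_le hle _ ENNReal.ofReal_ne_top)
  · refine tendsto_of_tendsto_of_tendsto_of_le_of_le tendsto_const_nhds
      (by simpa using ENNReal.Tendsto.const_mul h3 (Or.inr hc')) (fun _ => zero_le)
      (fun k => eLpNorm_le_of_measure_le hle _ ENNReal.ofReal_ne_top)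

theorem IsSobolevGrad.congr (hu : IsSobolevGrad μ p V u g) (h1 : u =ᵐ[μ.restrict V] v)
    (h2 : g =ᵐ[μ.restrict V] h) : IsSobolevGrad μ p V v h := by
  obtain ⟨h0, h0', φ, h3, h4, h5⟩ := hu
  refine ⟨h0.ae_eq h1, h0'.ae_eq h2, φ, h3, ?_, ?_⟩
  · refine h4.congr fun k => eLpNorm_congr_ae ?_
    filter_upwards [h1] with x hx
    rw [hx]
  · refine h5.congr fun k => eLpNorm_congr_ae ?_
    filter_upwards [h2] with x hx
    rw [hx]

/-- Sobolev functions are stable under composition with limits of smooth maps. -/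
theorem IsSobolevGrad.comp (hp : 1 ≤ p) (hu : IsSobolevGrad volume p W u g) (hV : IsOpen V)
    (hVfin : volume V ≠ ⊤) (hW : IsOpen W) {K : Set (E m)} (hK : IsCompact K) (hKW : K ⊆ W)
    {τ : E m → E m} (hτ : Measurable τ) {c : ℝ≥0∞} (hc : c ≠ ⊤)
    (hmap : (volume.restrict V).map τ ≤ c • volume.restrict W)
    {τs : ℕ → E m → E m} (hs : ∀ k, ContDiffOn ℝ ∞ (τs k) V)
    (hsK : ∀ k, Set.MapsTo (τs k) V K)
    (hlim : ∀ x ∈ V, Tendsto (fun k => τs k x) atTop (𝓝 (τ x)))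
    {M : E m → E m →L[ℝ] E m} {C : ℝ} (hC : ∀ k, ∀ x ∈ V, ‖fderiv ℝ (τs k) x‖ ≤ C)
    (hM : ∀ᵐ x ∂volume.restrict V,
      Tendsto (fun k => ContinuousLinearMap.adjoint (fderiv ℝ (τs k) x)) atTop (𝓝 (M x))) :
    IsSobolevGrad volume p V (fun x => u (τ x)) (fun x => M x (g (τ x))) := by
  have : IsFiniteMeasure (volume.restrict V) :=
    ⟨by rw [Measure.restrict_apply_univ]; exact hVfin.lt_top⟩
  have hp0 : 0 < p := by linarith
  set q := ENNReal.ofReal p with hq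
  have hq1 : 1 ≤ q := by rw [hq]; simpa using hp
  have hqt : q ≠ ⊤ := ENNReal.ofReal_ne_top
  have hVae : ∀ᵐ x ∂volume.restrict V, x ∈ V := ae_restrict_mem hV.measurableSet
  have hτK : ∀ x ∈ V, τ x ∈ K := fun x hx =>
    hK.isClosed.mem_of_tendsto (hlim x hx) (Eventually.of_forall fun k => hsK k hx)
  set μ := volume.restrict V with hμ
  have hMmeas : AEStronglyMeasurable M μ := by
    refine aestronglyMeasurable_of_tendsto_ae atTop (fun k => ?_) hM
    exact (ContinuousLinearMap.adjoint (𝕜 := ℝ) (E := E m) (F := E m)).continuous.comp_aestronglyMeasurable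
      (measurable_fderiv ℝ (τs k)).aestronglyMeasurable
  have hMC : ∀ᵐ x ∂μ, ‖M x‖ ≤ C := by
    filter_upwards [hM, hVae] with x h1 h2
    refine le_of_tendsto h1.norm (Eventually.of_forall fun k => ?_)
    rw [LinearIsometryEquiv.norm_map]
    exact hC k x h2
  have hMapp : ∀ {w : E m → E m}, AEStronglyMeasurable w μ →
      AEStronglyMeasurable (fun x => M x (w x)) μ := fun hw =>
    isBoundedBilinearMap_apply.continuous.comp_aestronglyMeasurable (hMmeas.prodMk hw)
  have hMle : ∀ (w : E m → E m), ∀ᵐ x ∂μ, ‖M x (w x)‖ ≤ C * ‖w x‖ := fun w => by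
    filter_upwards [hMC] with x hx
    exact (M x).le_of_opNorm_le hx _
  -- The push-forward of the measure on `V` is dominated by `c` times the measure on `W`, so
  -- composition with `τ` respects null sets and is bounded in `L^p`.
  have hcomp : ∀ {H : Type} [NormedAddCommGroup H] {w : E m → H},
      AEStronglyMeasurable w (volume.restrict W) →
      AEStronglyMeasurable (fun x => w (τ x)) μ ∧
      eLpNorm (fun x => w (τ x)) q μ ≤
        c ^ (1 / q).toReal * eLpNorm w q (volume.restrict W) := by
    intro H _ w hw
    have h1 : AEStronglyMeasurable w (μ.map τ) :=
      (hw.smul_measure c).mono_measure hmap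
    refine ⟨h1.comp_measurable hτ, ?_⟩
    have h2 := eLpNorm_map_measure (p := q) h1 hτ.aemeasurable
    rw [Function.comp_def] at h2
    rw [← h2]
    exact eLpNorm_le_of_measure_le hmap w hqt
  have hct : c ^ (1 / q).toReal ≠ ⊤ :=
    ENNReal.rpow_ne_top_of_nonneg ENNReal.toReal_nonneg hc
  set c' := c ^ (1 / q).toReal with hc'
  have hmem : ∀ {H : Type} [NormedAddCommGroup H] {w : E m → H},
      MemLp w q (volume.restrict W) → MemLp (fun x => w (τ x)) q μ := fun hw =>
    ⟨(hcomp hw.1).1, (hcomp hw.1).2.trans_lt (ENNReal.mul_lt_top hct.lt_top hw.2)⟩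
  have hgτ := hmem hu.2.1
  refine IsSobolevGrad.of_approx (hmem hu.1) (hgτ.of_le_mul (hMapp hgτ.1) (hMle _)) ?_
  intro ε hε
  -- first approximate on `W`, then replace `τ` by `τs k`
  obtain ⟨δ, hδ0, hδ⟩ : ∃ δ : ℝ≥0∞, δ ≠ 0 ∧ c' * δ ≤ ε / 2 ∧
      ENNReal.ofReal C * (c' * δ) ≤ ε / 2 := by
    have h1 : Tendsto (fun δ : ℝ≥0∞ => c' * δ) (𝓝 0) (𝓝 0) := by
      simpa using ENNReal.Tendsto.const_mul (tendsto_id (α := ℝ≥0∞) (x := 𝓝 0)) (Or.inr hct)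
    have h2 : Tendsto (fun δ : ℝ≥0∞ => ENNReal.ofReal C * (c' * δ)) (𝓝 0) (𝓝 0) := by
      simpa using ENNReal.Tendsto.const_mul h1 (Or.inr ENNReal.ofReal_ne_top)
    have h3 : (0 : ℝ≥0∞) < ε / 2 := ENNReal.half_pos hε
    have h4 := (h1.eventually (ge_mem_nhds h3)).and (h2.eventually (ge_mem_nhds h3))
    have h5 := (h4.filter_mono (nhdsWithin_le_nhds (s := Set.Ioi 0))).and self_mem_nhdsWithin
    obtain ⟨δ, h6, h7⟩ := h5.exists
    exact ⟨δ, (ne_of_gt h7), h6⟩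
  obtain ⟨φ, h1, h2, h3, h4, h5⟩ := hu.exists_approx hδ0
  have hφc : ContinuousOn φ W := h1.continuousOn
  have hφg : ContinuousOn (gradient φ) W := continuousOn_gradient hW h1
  -- The approximant need not be bounded on `W`, but it and its gradient are bounded on the compact
  -- set `K` containing all `τs k x`. This permits bounded convergence in `k`.
  obtain ⟨C₁, hC₁⟩ := hK.exists_bound_of_continuousOn (hφc.mono hKW)
  obtain ⟨C₂, hC₂⟩ := hK.exists_bound_of_continuousOn (hφg.mono hKW)
  have hsm : ∀ k, ContDiffOn ℝ ∞ (fun x => φ (τs k x)) V := fun k =>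
    h1.comp (hs k) fun x hx => hKW (hsK k hx)
  have hgr : ∀ k, ∀ x ∈ V, gradient (fun y => φ (τs k y)) x =
      ContinuousLinearMap.adjoint (fderiv ℝ (τs k) x) (gradient φ (τs k x)) := fun k x hx => by
    refine gradient_comp ?_ ?_
    · exact (h1.contDiffAt (hW.mem_nhds (hKW (hsK k hx)))).differentiableAt (by simp)
    · exact ((hs k).contDiffAt (hV.mem_nhds hx)).differentiableAt (by simp)
  have hm1 : ∀ k, AEStronglyMeasurable (fun x => φ (τs k x)) μ := fun k =>
    (hsm k).continuousOn.aestronglyMeasurable hV.measurableSet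
  have hb1 : ∀ k, ∀ᵐ x ∂μ, ‖φ (τs k x)‖ ≤ C₁ := fun k => by
    filter_upwards [hVae] with x hx using hC₁ _ (hsK k hx)
  have hl1 : ∀ᵐ x ∂μ, Tendsto (fun k => φ (τs k x)) atTop (𝓝 (φ (τ x))) := by
    filter_upwards [hVae] with x hx
    exact (hφc.continuousAt (hW.mem_nhds (hKW (hτK x hx)))).tendsto.comp (hlim x hx)
  have hm2 : ∀ k, AEStronglyMeasurable (gradient (fun y => φ (τs k y))) μ := fun k =>
    (continuousOn_gradient hV (hsm k)).aestronglyMeasurable hV.measurableSet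
  have hb2 : ∀ k, ∀ᵐ x ∂μ, ‖gradient (fun y => φ (τs k y)) x‖ ≤ C * C₂ := fun k => by
    filter_upwards [hVae] with x hx
    rw [hgr k x hx]
    refine (ContinuousLinearMap.le_opNorm _ _).trans ?_
    rw [LinearIsometryEquiv.norm_map]
    exact mul_le_mul (hC k x hx) (hC₂ _ (hsK k hx)) (norm_nonneg _)
      ((norm_nonneg _).trans (hC k x hx))
  have hl2 : ∀ᵐ x ∂μ, Tendsto (fun k => gradient (fun y => φ (τs k y)) x) atTop
      (𝓝 (M x (gradient φ (τ x)))) := by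
    filter_upwards [hVae, hM] with x hx hMx
    have h6 : Tendsto (fun k => gradient φ (τs k x)) atTop (𝓝 (gradient φ (τ x))) :=
      (hφg.continuousAt (hW.mem_nhds (hKW (hτK x hx)))).tendsto.comp (hlim x hx)
    have h7 := (isBoundedBilinearMap_apply (𝕜 := ℝ) (E := E m) (F := E m)).continuous.tendsto
      (M x, gradient φ (τ x)) |>.comp (hMx.prodMk_nhds h6)
    refine h7.congr fun k => ?_
    rw [hgr k x hx]; rfl
  have ht1 := tendsto_eLpNorm_of_bounded hp0 hm1 hb1 hl1
  have ht2 := tendsto_eLpNorm_of_bounded hp0 hm2 hb2 hl2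
  have h3' : (0 : ℝ≥0∞) < ε / 2 := ENNReal.half_pos hε
  obtain ⟨k, hk1, hk2⟩ :=
    ((ht1.eventually (ge_mem_nhds h3')).and (ht2.eventually (ge_mem_nhds h3'))).exists
  have hφ1 := hmem h2
  have hφ2 := hmem h3
  refine ⟨_, hsm k, MemLp.of_bound (hm1 k) _ (hb1 k), MemLp.of_bound (hm2 k) _ (hb2 k), ?_, ?_⟩
  · calc eLpNorm (fun x => φ (τs k x) - u (τ x)) q μ
        = eLpNorm ((fun x => φ (τs k x) - φ (τ x)) + fun x => φ (τ x) - u (τ x)) q μ := by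
          congr 1; ext x; simp
      _ ≤ eLpNorm (fun x => φ (τs k x) - φ (τ x)) q μ + eLpNorm (fun x => φ (τ x) - u (τ x)) q μ :=
          eLpNorm_add_le ((hm1 k).sub hφ1.1) (hφ1.1.sub (hmem hu.1).1) hq1
      _ ≤ ε / 2 + ε / 2 := by
          refine add_le_add hk1 (((hcomp (h2.1.sub hu.1.1)).2.trans ?_).trans hδ.1)
          exact mul_le_mul_right h4 _
      _ = ε := ENNReal.add_halves ε
  · calc eLpNorm (fun x => gradient (fun y => φ (τs k y)) x - M x (g (τ x))) q μ
        = eLpNorm ((fun x => gradient (fun y => φ (τs k y)) x - M x (gradient φ (τ x))) +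
            fun x => M x (gradient φ (τ x) - g (τ x))) q μ := by
          congr 1; ext1 x; simp
      _ ≤ eLpNorm (fun x => gradient (fun y => φ (τs k y)) x - M x (gradient φ (τ x))) q μ +
            eLpNorm (fun x => M x (gradient φ (τ x) - g (τ x))) q μ :=
          eLpNorm_add_le ((hm2 k).sub (hMapp hφ2.1)) (hMapp (hφ2.1.sub hgτ.1)) hq1
      _ ≤ ε / 2 + ε / 2 := by
          refine add_le_add hk2 (((eLpNorm_le_mul_eLpNorm_of_ae_le_mul (hMle _) q).trans ?_).trans
            hδ.2)
          refine mul_le_mul_right ((hcomp (h3.1.sub hu.2.1.1)).2.trans ?_) _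
          exact mul_le_mul_right h5 _
      _ = ε := ENNReal.add_halves ε

end Sobolev

/-! ### Multiplication by a cutoff function -/

theorem restrict_ae_eq_indicator {X H : Type*} [MeasurableSpace X] [Zero H] {μ : Measure X}
    {V W : Set X} (hV : MeasurableSet V) {f : X → H} (h : ∀ x ∈ V, x ∉ W → f x = 0) :
    f =ᵐ[μ.restrict V] W.indicator f := by
  filter_upwards [ae_restrict_mem hV] with x hx
  by_cases hw : x ∈ W
  · rw [Set.indicator_of_mem hw]
  · rw [Set.indicator_of_notMem hw, h x hx hw]

theorem eLpNorm_restrict_of_eq_zero {X H : Type*} [MeasurableSpace X] [NormedAddCommGroup H]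
    {μ : Measure X} {V W : Set X} (hV : MeasurableSet V) (hW : MeasurableSet W) (hWV : W ⊆ V)
    {f : X → H} (h : ∀ x ∈ V, x ∉ W → f x = 0) (q : ℝ≥0∞) :
    eLpNorm f q (μ.restrict V) = eLpNorm f q (μ.restrict W) := by
  rw [eLpNorm_congr_ae (restrict_ae_eq_indicator hV h), eLpNorm_indicator_eq_eLpNorm_restrict hW,
    Measure.restrict_restrict_of_subset hWV]

theorem memLp_restrict_of_eq_zero {X H : Type*} [MeasurableSpace X] [NormedAddCommGroup H]
    {μ : Measure X} {V W : Set X} (hV : MeasurableSet V) (hW : MeasurableSet W) (hWV : W ⊆ V)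
    {f : X → H} (h : ∀ x ∈ V, x ∉ W → f x = 0) {q : ℝ≥0∞} (hf : MemLp f q (μ.restrict W)) :
    MemLp f q (μ.restrict V) := by
  rw [memLp_congr_ae (restrict_ae_eq_indicator hV h), memLp_indicator_iff_restrict hW,
    Measure.restrict_restrict_of_subset hWV]
  exact hf

/-- Extension by zero stays smooth: near a point of `W` it is a product of smooth functions, near a
point of `Z` it vanishes identically. -/
theorem contDiffOn_mul_of_eq_zero {V W Z : Set (E m)} {χ φ : E m → ℝ} (hV : IsOpen V)
    (hW : IsOpen W) (hZ : IsOpen Z) (hVZ : V ⊆ W ∪ Z) (hχ : ContDiffOn ℝ ∞ χ V)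
    (h0 : ∀ x ∈ V, x ∈ Z → χ x = 0) (hφ : ContDiffOn ℝ ∞ φ W) :
    ContDiffOn ℝ ∞ (fun x => χ x * φ x) V := by
  intro x hx
  refine ContDiffAt.contDiffWithinAt ?_
  rcases hVZ hx with h | h
  · exact (hχ.contDiffAt (hV.mem_nhds hx)).mul (hφ.contDiffAt (hW.mem_nhds h))
  · refine (contDiffAt_const (c := (0 : ℝ))).congr_of_eventuallyEq ?_
    filter_upwards [hV.mem_nhds hx, hZ.mem_nhds h] with y hy hy'
    rw [h0 y hy hy', zero_mul]

/-- `u` is known only on `W`, but `χ` vanishes near every point of `V \ W`. So the products of `χ`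
with the approximants are smooth on all of `V`, and they converge by the product rule. -/
theorem IsSobolevGrad.cutoff {p : ℝ} (hp : 1 ≤ p) {V W Z : Set (E m)} {u : E m → ℝ}
    {g : E m → E m} (hu : IsSobolevGrad volume p W u g) (hV : IsOpen V) (hW : IsOpen W)
    (hZ : IsOpen Z) (hWV : W ⊆ V) (hVZ : V ⊆ W ∪ Z) {χ : E m → ℝ} (hχ : ContDiffOn ℝ ∞ χ V)
    (h0 : ∀ x ∈ V, x ∈ Z → χ x = 0) {C : ℝ} (hC : ∀ x ∈ V, ‖χ x‖ ≤ C)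
    (hC' : ∀ x ∈ V, ‖gradient χ x‖ ≤ C) :
    IsSobolevGrad volume p V (fun x => χ x * u x)
      (fun x => χ x • g x + u x • gradient χ x) := by
  have hq1 : 1 ≤ ENNReal.ofReal p := by simpa using hp
  have hχW : AEStronglyMeasurable χ (volume.restrict W) :=
    (hχ.continuousOn.mono hWV).aestronglyMeasurable hW.measurableSet
  have hχW' : AEStronglyMeasurable (gradient χ) (volume.restrict W) :=
    ((continuousOn_gradient hV hχ).mono hWV).aestronglyMeasurable hW.measurableSet
  have hz : ∀ x ∈ V, x ∉ W → χ x = 0 := fun x hx hw => h0 x hx ((hVZ hx).resolve_left hw)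
  have hz' : ∀ x ∈ V, x ∉ W → gradient χ x = 0 := fun x hx hw => by
    have h1 : χ =ᶠ[𝓝 x] fun _ => (0 : ℝ) := by
      filter_upwards [hV.mem_nhds hx, hZ.mem_nhds ((hVZ hx).resolve_left hw)] with y hy hy'
      exact h0 y hy hy'
    rw [gradient_congr h1, gradient_fun_const]
  have hWae : ∀ᵐ x ∂(volume.restrict W : Measure (E m)), x ∈ W := ae_restrict_mem hW.measurableSet
  have hle1 : ∀ w : E m → ℝ, ∀ᵐ x ∂(volume.restrict W : Measure (E m)),
      ‖χ x * w x‖ ≤ C * ‖w x‖ := fun w => by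
    filter_upwards [hWae] with x hx
    rw [norm_mul]
    exact mul_le_mul_of_nonneg_right (hC x (hWV hx)) (norm_nonneg _)
  have hle2 : ∀ w : E m → E m, ∀ᵐ x ∂(volume.restrict W : Measure (E m)),
      ‖χ x • w x‖ ≤ C * ‖w x‖ := fun w => by
    filter_upwards [hWae] with x hx
    rw [norm_smul]
    exact mul_le_mul_of_nonneg_right (hC x (hWV hx)) (norm_nonneg _)
  have hle3 : ∀ w : E m → ℝ, ∀ᵐ x ∂(volume.restrict W : Measure (E m)),
      ‖w x • gradient χ x‖ ≤ C * ‖w x‖ := fun w => by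
    filter_upwards [hWae] with x hx
    rw [norm_smul, mul_comm]
    exact mul_le_mul_of_nonneg_right (hC' x (hWV hx)) (norm_nonneg _)
  have hmem : ∀ {w : E m → ℝ} {k : E m → E m},
      MemLp w (ENNReal.ofReal p) (volume.restrict W) →
      MemLp k (ENNReal.ofReal p) (volume.restrict W) →
      MemLp (fun x => χ x * w x) (ENNReal.ofReal p) (volume.restrict V) ∧
      MemLp (fun x => χ x • k x + w x • gradient χ x) (ENNReal.ofReal p)
        (volume.restrict V) := by
    intro w k hw hk
    constructor
    · refine memLp_restrict_of_eq_zero hV.measurableSet hW.measurableSet hWV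
        (fun x hx hx' => by rw [hz x hx hx', zero_mul]) ?_
      exact hw.of_le_mul (hχW.mul hw.1) (hle1 w)
    · refine memLp_restrict_of_eq_zero hV.measurableSet hW.measurableSet hWV
        (fun x hx hx' => by rw [hz x hx hx', hz' x hx hx']; simp) ?_
      exact (hk.of_le_mul (hχW.smul hk.1) (hle2 k)).add
        (hw.of_le_mul (hw.1.smul hχW') (hle3 w))
  have hgr : ∀ φ : E m → ℝ, ContDiffOn ℝ ∞ φ W → ∀ x ∈ V, gradient (fun y => χ y * φ y) x =
      χ x • gradient φ x + φ x • gradient χ x := by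
    intro φ hφ x hx
    by_cases hxW : x ∈ W
    · exact gradient_mul ((hχ.contDiffAt (hV.mem_nhds hx)).differentiableAt (by simp))
        ((hφ.contDiffAt (hW.mem_nhds hxW)).differentiableAt (by simp))
    · have h1 : (fun y => χ y * φ y) =ᶠ[𝓝 x] fun _ => (0 : ℝ) := by
        filter_upwards [hV.mem_nhds hx, hZ.mem_nhds ((hVZ hx).resolve_left hxW)] with y hy hy'
        rw [h0 y hy hy', zero_mul]
      rw [gradient_congr h1, gradient_fun_const, hz x hx hxW, hz' x hx hxW]; simp
  have hVae : ∀ᵐ x ∂(volume.restrict V : Measure (E m)), x ∈ V := ae_restrict_mem hV.measurableSet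
  obtain ⟨hum, hgm, φ, h1, h2, h3⟩ := hu
  have h2' := ENNReal.Tendsto.const_mul (a := ENNReal.ofReal C) h2 (Or.inr ENNReal.ofReal_ne_top)
  have h3' := ENNReal.Tendsto.const_mul (a := ENNReal.ofReal C) h3 (Or.inr ENNReal.ofReal_ne_top)
  refine ⟨(hmem hum hgm).1, (hmem hum hgm).2, fun k x => χ x * φ k x, fun k =>
    ⟨contDiffOn_mul_of_eq_zero hV hW hZ hVZ hχ h0 (h1 k).1, (hmem (h1 k).2.1 (h1 k).2.2).1, ?_⟩,
    ?_, ?_⟩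
  · refine ((hmem (h1 k).2.1 (h1 k).2.2).2).ae_eq ?_
    filter_upwards [hVae] with x hx
    rw [hgr _ (h1 k).1 x hx]
  · rw [mul_zero] at h2'
    refine tendsto_of_tendsto_of_tendsto_of_le_of_le tendsto_const_nhds h2' (fun _ => zero_le)
      fun k => ?_
    rw [eLpNorm_restrict_of_eq_zero hV.measurableSet hW.measurableSet hWV
      (fun x hx hx' => by simp [hz x hx hx'])]
    refine eLpNorm_le_mul_eLpNorm_of_ae_le_mul ?_ _
    filter_upwards [hle1 fun x => φ k x - u x] with x hx
    rwa [← mul_sub]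
  · have h4 := h2'.add h3'
    rw [mul_zero, add_zero] at h4
    refine tendsto_of_tendsto_of_tendsto_of_le_of_le tendsto_const_nhds h4 (fun _ => zero_le)
      fun k => ?_
    have h5 : (fun x => gradient (fun y => χ y * φ k y) x - (χ x • g x + u x • gradient χ x))
        =ᵐ[volume.restrict V] (fun x => (φ k x - u x) • gradient χ x) +
          (fun x => χ x • (gradient (φ k) x - g x)) := by
      filter_upwards [hVae] with x hx
      rw [hgr _ (h1 k).1 x hx]
      simp only [Pi.add_apply]
      module
    rw [eLpNorm_congr_ae h5, eLpNorm_restrict_of_eq_zero hV.measurableSet hW.measurableSet hWV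
      (fun x hx hx' => by simp [hz x hx hx', hz' x hx hx'])]
    refine (eLpNorm_add_le (((h1 k).2.1.1.sub hum.1).smul hχW')
      (hχW.smul ((h1 k).2.2.1.sub hgm.1)) hq1).trans (add_le_add ?_ ?_)
    · exact eLpNorm_le_mul_eLpNorm_of_ae_le_mul (hle3 _) _
    · exact eLpNorm_le_mul_eLpNorm_of_ae_le_mul (hle2 _) _

/-! ### Uniqueness of the gradient -/

theorem tendsto_integral_of_eLpNorm {X H H' : Type*} [MeasurableSpace X] {μ : Measure X}
    [IsFiniteMeasure μ] [NormedAddCommGroup H] [NormedSpace ℝ H] [NormedAddCommGroup H']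
    {q : ℝ≥0∞} (hq : 1 ≤ q) {a : ℕ → X → H} {a' : X → H} {f : ℕ → X → H'} {f' : X → H'} {C : ℝ}
    (ha : ∀ k, Integrable (a k) μ) (ha' : Integrable a' μ)
    (hf : ∀ k, AEStronglyMeasurable (fun x => f k x - f' x) μ)
    (hle : ∀ k, ∀ᵐ x ∂μ, ‖a k x - a' x‖ ≤ C * ‖f k x - f' x‖)
    (hlim : Tendsto (fun k => eLpNorm (fun x => f k x - f' x) q μ) atTop (𝓝 0)) :
    Tendsto (fun k => ∫ x, a k x ∂μ) atTop (𝓝 (∫ x, a' x ∂μ)) := by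
  refine tendsto_integral_of_L1' _ ha'.1 (Eventually.of_forall ha) ?_
  -- By Hölder's inequality on a finite measure space, this constant controls the `L¹` norm of the
  -- difference by the `L^q` norm.
  have hfin : ENNReal.ofReal C * μ Set.univ ^ (1 / (1 : ℝ≥0∞).toReal - 1 / q.toReal) ≠ ⊤ := by
    refine ENNReal.mul_ne_top ENNReal.ofReal_ne_top
      (ENNReal.rpow_ne_top_of_nonneg ?_ (measure_ne_top _ _))
    by_cases hqt : q = ⊤
    · simp [hqt]
    · have : 1 ≤ q.toReal := by
        simpa using ENNReal.toReal_mono hqt hq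
      simp only [ENNReal.toReal_one, ne_eq, one_ne_zero, not_false_eq_true, div_self, sub_nonneg]
      exact div_le_one_of_le₀ this (by linarith)
  have h1 := ENNReal.Tendsto.const_mul hlim (Or.inr hfin)
  rw [mul_zero] at h1
  refine tendsto_of_tendsto_of_tendsto_of_le_of_le tendsto_const_nhds h1 (fun _ => zero_le)
    fun k => ?_
  refine (eLpNorm_le_mul_eLpNorm_of_ae_le_mul (hle k) 1).trans ?_
  rw [mul_assoc]
  refine mul_le_mul_right ?_ _
  rw [mul_comm]
  exact eLpNorm_le_eLpNorm_mul_rpow_measure_univ hq (hf k)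

/-- Integration by parts against the constant `1`, in one direction `e` at a time. -/
theorem integral_gradient_eq_zero {f : E m → ℝ} (hf : ContDiff ℝ ∞ f) (hc : HasCompactSupport f) :
    ∫ x, gradient f x = 0 := by
  have hint : Integrable (gradient f) :=
    (continuous_gradient hf).integrable_of_hasCompactSupport
      (hc.mono' (support_gradient_subset f))
  refine ext_inner_left ℝ fun e => ?_
  rw [inner_zero_right, ← integral_inner hint e]
  have hint' : Integrable (fun x => fderiv ℝ f x e) := by
    refine (hint.inner_const (𝕜 := ℝ) e).congr (Eventually.of_forall fun x => ?_)
    exact inner_gradient f x e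
  have h := integral_mul_fderiv_eq_neg_fderiv_mul_of_integrable (μ := volume)
    (f := fun _ : E m => (1 : ℝ)) (g := f) (v := e) (by simp) (by simpa using hint')
    (by simpa using hf.continuous.integrable_of_hasCompactSupport hc)
    (fun x _ => differentiableAt_const _) (fun x _ => hf.differentiable (by simp) x)
  simp only [one_mul, fderiv_fun_const, Pi.zero_apply, zero_apply, zero_mul,
    integral_zero, neg_zero] at h
  rw [← h]
  refine integral_congr_ae (Eventually.of_forall fun x => ?_)
  simp only
  rw [real_inner_comm, inner_gradient]

/-- For the smooth approximants this is the vanishing of the integral of `∇(ψ φ)`. Both sides pass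
to the limit because `ψ` and its gradient are bounded. Thus the limit gradient is the distributional
one. -/
theorem IsSobolevGradLoc.integral_smul {p : ℝ} (hp : 1 ≤ p) {Ω : Set (E m)} (hΩ : IsOpen Ω)
    {u : E m → ℝ} {g : E m → E m} (hu : IsSobolevGradLoc volume p Ω u g) {ψ : E m → ℝ}
    (hψ : IsTestFun Ω ψ) : ∫ x, ψ x • g x = -∫ x, u x • gradient ψ x := by
  obtain ⟨hψ1, hψ2, hψ3⟩ := hψ
  obtain ⟨V, hV, hKV, hVΩ, hVc⟩ :=
    exists_open_between_and_isCompact_closure (K := tsupport ψ) hψ2 hΩ hψ3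
  have hfin : volume V ≠ ⊤ := ((measure_mono subset_closure).trans_lt hVc.measure_lt_top).ne
  have : IsFiniteMeasure (volume.restrict V) :=
    ⟨by rw [Measure.restrict_apply_univ]; exact hfin.lt_top⟩
  have hq1 : 1 ≤ ENNReal.ofReal p := by simpa using hp
  obtain ⟨hum, hgm, φ, h1, h2, h3⟩ := hu V hV hVc hVΩ
  have hz : ∀ x, x ∉ V → ψ x = 0 := fun x hx => image_eq_zero_of_notMem_tsupport fun h => hx (hKV h)
  have hz' : ∀ x, x ∉ V → gradient ψ x = 0 := fun x hx => by
    by_contra h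
    exact hx (hKV (support_gradient_subset ψ h))
  obtain ⟨C, hC⟩ := hψ2.exists_bound_of_continuous hψ1.continuous
  obtain ⟨C', hC'⟩ := (hψ2.mono' (support_gradient_subset ψ)).exists_bound_of_continuous
    (continuous_gradient hψ1)
  have hi1 : ∀ {k : E m → E m}, MemLp k (ENNReal.ofReal p) (volume.restrict V) →
      Integrable (fun x => ψ x • k x) (volume.restrict V) := fun {k} hk =>
    memLp_one_iff_integrable.1 ((hk.mono_exponent hq1).of_le_mul
      (hψ1.continuous.aestronglyMeasurable.smul hk.1) (c := C)
      (Eventually.of_forall fun x => by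
        rw [norm_smul]; exact mul_le_mul_of_nonneg_right (hC x) (norm_nonneg _)))
  have hi2 : ∀ {w : E m → ℝ}, MemLp w (ENNReal.ofReal p) (volume.restrict V) →
      Integrable (fun x => w x • gradient ψ x) (volume.restrict V) := fun {w} hw =>
    memLp_one_iff_integrable.1 ((hw.mono_exponent hq1).of_le_mul
      (hw.1.smul (continuous_gradient hψ1).aestronglyMeasurable) (c := C')
      (Eventually.of_forall fun x => by
        rw [norm_smul, mul_comm]; exact mul_le_mul_of_nonneg_right (hC' x) (norm_nonneg _)))
  have hl1 := tendsto_integral_of_eLpNorm hq1 (C := C) (fun k => hi1 (h1 k).2.2) (hi1 hgm)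
    (fun k => (h1 k).2.2.1.sub hgm.1) (fun k => Eventually.of_forall fun x => by
      rw [← smul_sub, norm_smul]
      exact mul_le_mul_of_nonneg_right (hC x) (norm_nonneg _)) h3
  have hl2 := tendsto_integral_of_eLpNorm hq1 (C := C') (fun k => hi2 (h1 k).2.1) (hi2 hum)
    (fun k => (h1 k).2.1.1.sub hum.1) (fun k => Eventually.of_forall fun x => by
      rw [← sub_smul, norm_smul, mul_comm]
      exact mul_le_mul_of_nonneg_right (hC' x) (norm_nonneg _)) h2
  have hsum : ∀ k, ∫ x in V, ψ x • gradient (φ k) x = -∫ x in V, φ k x • gradient ψ x := by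
    intro k
    have hs : ContDiff ℝ ∞ (fun x => ψ x * φ k x) := by
      rw [← contDiffOn_univ]
      refine contDiffOn_mul_of_eq_zero isOpen_univ hV (isClosed_tsupport ψ).isOpen_compl ?_
        hψ1.contDiffOn (fun x _ hx => image_eq_zero_of_notMem_tsupport hx) (h1 k).1
      intro x _
      by_cases hx : x ∈ tsupport ψ
      · exact Or.inl (hKV hx)
      · exact Or.inr hx
    have h4 := integral_gradient_eq_zero hs hψ2.mul_right
    have h5 : ∫ x in V, gradient (fun x => ψ x * φ k x) x = 0 := by
      rw [← h4]
      refine setIntegral_eq_integral_of_forall_compl_eq_zero fun x hx => ?_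
      by_contra h
      refine hx (hKV ?_)
      exact closure_mono (Function.support_mul_subset_left _ _)
        (support_gradient_subset (fun x => ψ x * φ k x) h)
    rw [setIntegral_congr_fun hV.measurableSet fun x hx => gradient_mul
      (hψ1.differentiable (by simp) x)
      (((h1 k).1.contDiffAt (hV.mem_nhds hx)).differentiableAt (by simp)),
      integral_add (hi1 (h1 k).2.2) (hi2 (h1 k).2.1)] at h5
    exact eq_neg_of_add_eq_zero_left h5
  have h6 := tendsto_nhds_unique hl1 (hl2.neg.congr fun k => (hsum k).symm)
  rwa [setIntegral_eq_integral_of_forall_compl_eq_zero (fun x hx => by simp [hz x hx]),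
    setIntegral_eq_integral_of_forall_compl_eq_zero (fun x hx => by simp [hz' x hx])] at h6

theorem IsSobolevGradLoc.locallyIntegrableOn {p : ℝ} (hp : 1 ≤ p) {Ω : Set (E m)}
    (hΩ : IsOpen Ω) {u : E m → ℝ} {g : E m → E m} (hu : IsSobolevGradLoc volume p Ω u g) :
    LocallyIntegrableOn u Ω ∧ LocallyIntegrableOn g Ω := by
  have hq1 : 1 ≤ ENNReal.ofReal p := by simpa using hp
  have h : ∀ K ⊆ Ω, IsCompact K → IntegrableOn u K ∧ IntegrableOn g K := by
    intro K hK hKc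
    obtain ⟨V, hV, hKV, hVΩ, hVc⟩ := exists_open_between_and_isCompact_closure hKc hΩ hK
    have hfin : volume V ≠ ⊤ := ((measure_mono subset_closure).trans_lt hVc.measure_lt_top).ne
    have : IsFiniteMeasure (volume.restrict V) :=
      ⟨by rw [Measure.restrict_apply_univ]; exact hfin.lt_top⟩
    obtain ⟨hum, hgm, -⟩ := hu V hV hVc hVΩ
    exact ⟨IntegrableOn.mono_set (hum.integrable hq1) hKV,
      IntegrableOn.mono_set (hgm.integrable hq1) hKV⟩
  constructor
  · exact (locallyIntegrableOn_iff hΩ.isLocallyClosed).2 fun K hK hc => (h K hK hc).1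
  · exact (locallyIntegrableOn_iff hΩ.isLocallyClosed).2 fun K hK hc => (h K hK hc).2

/-- The difference of the gradients integrates to zero against every test function, hence vanishes
a.e. Since weak solutions come with a chosen gradient, this is what lets evenness pass from the
function to that gradient. -/
theorem IsSobolevGradLoc.gradient_unique {p : ℝ} (hp : 1 ≤ p) {Ω : Set (E m)} (hΩ : IsOpen Ω)
    {u v : E m → ℝ} {g h : E m → E m} (hu : IsSobolevGradLoc volume p Ω u g)
    (hv : IsSobolevGradLoc volume p Ω v h) (huv : u =ᵐ[volume.restrict Ω] v) :
    g =ᵐ[volume.restrict Ω] h := by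
  have hg := (hu.locallyIntegrableOn hp hΩ).2
  have hh := (hv.locallyIntegrableOn hp hΩ).2
  have key := hΩ.ae_eq_zero_of_integral_contDiff_smul_eq_zero (hg.sub hh) ?_
  · rw [EventuallyEq, ae_restrict_iff' hΩ.measurableSet]
    filter_upwards [key] with x hx hxΩ
    exact sub_eq_zero.1 (hx hxΩ)
  · intro ψ h1 h2 h3
    have hψ : IsTestFun Ω ψ := ⟨h1, h2, h3⟩
    have h4 := hu.integral_smul hp hΩ hψ
    have h5 := hv.integral_smul hp hΩ hψ
    have h6 : ∫ x, u x • gradient ψ x = ∫ x, v x • gradient ψ x := by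
      have hz : ∀ w : E m → ℝ, ∀ x, x ∉ Ω → w x • gradient ψ x = 0 := fun w x hx => by
        have : gradient ψ x = 0 := by
          by_contra h
          exact hx (h3 (support_gradient_subset ψ h))
        rw [this, smul_zero]
      rw [← setIntegral_eq_integral_of_forall_compl_eq_zero (hz u),
        ← setIntegral_eq_integral_of_forall_compl_eq_zero (hz v)]
      refine integral_congr_ae ?_
      filter_upwards [huv] with x hx
      rw [hx]
    have hint : ∀ {k : E m → E m}, LocallyIntegrableOn k Ω → Integrable (fun x => ψ x • k x) :=
      fun {k} hk => by
        refine (integrableOn_iff_integrable_of_support_subset (s := tsupport ψ) ?_).1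
          ((hk.integrableOn_compact_subset h3 h2).continuousOn_smul h1.continuous.continuousOn h2)
        exact (Function.support_smul_subset_left ψ k).trans (subset_tsupport ψ)
    simp only [Pi.sub_apply, smul_sub]
    rw [integral_sub (hint hg) (hint hh), h4, h5, h6, sub_self]

/-! ### Comparison of measures -/

theorem volume_T_image {κ : ℝ} (hκ : 0 < κ) {s : Set (E m)} (hs : MeasurableSet s) :
    ∫⁻ x in s, ENNReal.ofReal |(fderiv ℝ (T κ) x).det| = volume (T κ '' s) :=
  lintegral_abs_det_fderiv_eq_addHaar_image volume hs
    (fun x _ => (differentiableAt_T κ x).hasFDerivAt.hasFDerivWithinAt) (T_injective hκ).injOn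

theorem exists_volume_T_image_le {κ : ℝ} (hκ : 0 < κ) {K : Set (E m)} (hK : IsCompact K) :
    ∃ c : ℝ≥0∞, c ≠ ⊤ ∧ ∀ s ⊆ K, MeasurableSet s → volume (T κ '' s) ≤ c * volume s := by
  obtain ⟨C, hC⟩ := hK.exists_bound_of_continuousOn (continuous_det_fderiv_T κ).continuousOn
  refine ⟨ENNReal.ofReal C, ENNReal.ofReal_ne_top, fun s hs hm => ?_⟩
  rw [← volume_T_image hκ hm, ← setLIntegral_const]
  refine setLIntegral_mono' hm fun x hx => ENNReal.ofReal_le_ofReal ?_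
  exact (le_abs_self _).trans (hC x (hs hx))

theorem exists_volume_le_T_image {κ : ℝ} (hκ : 0 < κ) {K : Set (E m)} (hK : IsCompact K) :
    ∃ c : ℝ≥0∞, c ≠ ⊤ ∧ ∀ s ⊆ K, MeasurableSet s → volume s ≤ c * volume (T κ '' s) := by
  have hpos : ∀ x : E m, 0 < |(fderiv ℝ (T κ) x).det| := fun x =>
    abs_pos.2 (det_fderiv_T_ne_zero hκ x)
  obtain ⟨C, hC⟩ := hK.exists_bound_of_continuousOn
    ((continuous_det_fderiv_T (m := m) κ).inv₀ fun x => (hpos x).ne').continuousOn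
  refine ⟨ENNReal.ofReal C, ENNReal.ofReal_ne_top, fun s hs hm => ?_⟩
  rw [← volume_T_image hκ hm, ← lintegral_const_mul' _ _ ENNReal.ofReal_ne_top, ← setLIntegral_one]
  refine setLIntegral_mono' hm fun x hx => ?_
  have h1 := (le_abs_self _).trans (hC x (hs hx))
  have h0 : 0 ≤ C := (inv_nonneg.2 (hpos x).le).trans h1
  rw [← ENNReal.ofReal_mul h0, ← ENNReal.ofReal_one]
  refine ENNReal.ofReal_le_ofReal ?_
  exact (inv_le_iff_one_le_mul₀ (hpos x)).1 h1

theorem exists_map_T_le {κ : ℝ} (hκ : 0 < κ) {V W : Set (E m)} (hV : MeasurableSet V)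
    (hVc : IsCompact (closure V)) (hVW : Set.MapsTo (T κ) V W) :
    ∃ c : ℝ≥0∞, c ≠ ⊤ ∧ (volume.restrict V).map (T κ) ≤ c • volume.restrict W := by
  obtain ⟨c, hc, h⟩ := exists_volume_le_T_image hκ hVc
  refine ⟨c, hc, Measure.le_iff.2 fun s hs => ?_⟩
  have hm := (continuous_T κ).measurable hs
  rw [Measure.map_apply (continuous_T κ).measurable hs, Measure.restrict_apply hm,
    Measure.smul_apply, Measure.restrict_apply hs, smul_eq_mul]
  refine (h _ (Set.inter_subset_right.trans subset_closure) (hm.inter hV)).trans ?_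
  refine mul_le_mul_right (measure_mono ?_) _
  rintro _ ⟨x, ⟨h1, h2⟩, rfl⟩
  exact ⟨h1, hVW h2⟩

/-- A point of the preimage of `s` lies in the `T`-image of `s` or in its mirror image, which
accounts for the factor `2`. The Jacobian of `T` is bounded on the compact set `unfold κ '' closure
V`. -/
theorem exists_map_unfold_le {κ : ℝ} (hκ : 0 < κ) {V W : Set (E m)}
    (hVc : IsCompact (closure V)) (hV0 : closure V ⊆ {0}ᶜ) (hVW : Set.MapsTo (unfold κ) (closure V) W) :
    ∃ c : ℝ≥0∞, c ≠ ⊤ ∧ (volume.restrict V).map (unfold κ) ≤ c • volume.restrict W := by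
  have hL : IsCompact (unfold κ '' closure V) :=
    hVc.image_of_continuousOn ((continuousOn_unfold κ).mono hV0)
  obtain ⟨c, hc, h⟩ := exists_volume_T_image_le hκ hL
  refine ⟨2 * c, ENNReal.mul_ne_top (by simp) hc, Measure.le_iff.2 fun s hs => ?_⟩
  rw [Measure.map_apply (measurable_unfold κ) hs,
    Measure.restrict_apply (measurable_unfold κ hs), Measure.smul_apply, Measure.restrict_apply hs,
    smul_eq_mul]
  set t := T κ '' (s ∩ unfold κ '' closure V) with htdef
  have h1 : unfold κ ⁻¹' s ∩ V ⊆ t ∪ P ⁻¹' t := by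
    rintro ξ ⟨h2, h3⟩
    have h4 : ξ ∈ closure V := subset_closure h3
    have h5 : fold ξ ∈ t := ⟨unfold κ ξ, ⟨h2, ξ, h4, rfl⟩, T_unfold hκ (hV0 h4)⟩
    rcases le_total 0 (ht ξ) with h6 | h6
    · rw [fold_of_nonneg h6] at h5; exact Or.inl h5
    · rw [fold_of_nonpos h6] at h5; exact Or.inr h5
  have h2 : volume t ≤ c * volume (s ∩ W) := by
    refine (h _ Set.inter_subset_right (hs.inter hL.measurableSet)).trans ?_
    refine mul_le_mul_right (measure_mono ?_) _
    rintro x ⟨hx, ξ, hξ, rfl⟩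
    exact ⟨hx, hVW hξ⟩
  calc volume (unfold κ ⁻¹' s ∩ V) ≤ volume t + volume (P ⁻¹' t) :=
        (measure_mono h1).trans (measure_union_le _ _)
    _ = volume t + volume t := by
        rw [measurePreserving_P.measure_preimage_emb measurableEmbedding_P]
    _ ≤ c * volume (s ∩ W) + c * volume (s ∩ W) := add_le_add h2 h2
    _ = 2 * c * volume (s ∩ W) := by ring

theorem exists_wMeasure_le (p : ℝ) {V : Set (E m)} (hV : MeasurableSet V)
    (hVc : IsCompact (closure V)) (hV0 : closure V ⊆ {0}ᶜ) :
    ∃ c : ℝ≥0∞, c ≠ ⊤ ∧ (wMeasure m p).restrict V ≤ c • volume.restrict V ∧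
      volume.restrict V ≤ c • (wMeasure m p).restrict V := by
  have hcont : ∀ a : ℝ, ContinuousOn (fun ξ : E m => ‖ξ‖ ^ a) (closure V) := fun a =>
    continuous_norm.continuousOn.rpow_const fun x hx => Or.inl (norm_ne_zero_iff.2 (hV0 hx))
  set a : ℝ := p - ((m : ℝ) + 1) with ha
  obtain ⟨C₁, hC₁⟩ := hVc.exists_bound_of_continuousOn (hcont a)
  obtain ⟨C₂, hC₂⟩ := hVc.exists_bound_of_continuousOn (hcont (-a))
  have hVae : ∀ᵐ ξ ∂(volume.restrict V : Measure (E m)), ξ ∈ V := ae_restrict_mem hV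
  have h1 : (wMeasure m p).restrict V ≤ ENNReal.ofReal C₁ • volume.restrict V := by
    rw [wMeasure, restrict_withDensity hV, ← withDensity_const]
    refine withDensity_mono ?_
    filter_upwards [hVae] with ξ hξ
    exact ENNReal.ofReal_le_ofReal ((le_abs_self _).trans (hC₁ ξ (subset_closure hξ)))
  have h2 : volume.restrict V ≤ ENNReal.ofReal C₂ • (wMeasure m p).restrict V := by
    rw [wMeasure, restrict_withDensity hV, ← withDensity_smul' _ _ ENNReal.ofReal_ne_top]
    nth_rw 1 [← withDensity_one (μ := volume.restrict V)]
    refine withDensity_mono ?_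
    filter_upwards [hVae] with ξ hξ
    have h3 : 0 < ‖ξ‖ := norm_pos_iff.2 (hV0 (subset_closure hξ))
    have h4 := (le_abs_self _).trans (hC₂ ξ (subset_closure hξ))
    simp only [Pi.one_apply, Pi.smul_apply, smul_eq_mul]
    rw [← ENNReal.ofReal_mul ((Real.rpow_nonneg h3.le _).trans h4), ← ENNReal.ofReal_one]
    refine ENNReal.ofReal_le_ofReal ?_
    have h5 : ‖ξ‖ ^ (-a) * ‖ξ‖ ^ a = 1 := by
      rw [← Real.rpow_add h3]; simp
    exact h5.symm.trans_le (mul_le_mul_of_nonneg_right h4 (Real.rpow_nonneg h3.le _))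
  refine ⟨max (ENNReal.ofReal C₁) (ENNReal.ofReal C₂), by simp, h1.trans ?_, h2.trans ?_⟩
  · exact Measure.le_iff.2 fun s _ => mul_le_mul_left (le_max_left _ _) _
  · exact Measure.le_iff.2 fun s _ => mul_le_mul_left (le_max_right _ _) _

/-- On compact sets avoiding the origin the weight lies between positive constants. As `0` belongs
to `Ftilde κ F`, this applies to `D`. -/
theorem isSobolevGradLoc_wMeasure_iff {p : ℝ} {Ω : Set (E m)} (hΩ : ∀ ξ ∈ Ω, ξ ≠ 0) {u : E m → ℝ}
    {g : E m → E m} :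
    IsSobolevGradLoc (wMeasure m p) p Ω u g ↔ IsSobolevGradLoc volume p Ω u g := by
  constructor
  · intro h V hV hVc hVΩ
    obtain ⟨c, hc, -, h2⟩ := exists_wMeasure_le p hV.measurableSet hVc fun x hx => hΩ x (hVΩ hx)
    exact (h V hV hVc hVΩ).mono_measure subset_rfl hc h2
  · intro h V hV hVc hVΩ
    obtain ⟨c, hc, h1, -⟩ := exists_wMeasure_le p hV.measurableSet hVc fun x hx => hΩ x (hVΩ hx)
    exact (h V hV hVc hVΩ).mono_measure subset_rfl hc h1

theorem IsSobolevGradLoc.congr {μ : Measure (E m)} {p : ℝ} {Ω : Set (E m)} {u v : E m → ℝ}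
    {g h : E m → E m} (hu : IsSobolevGradLoc μ p Ω u g) (h1 : u =ᵐ[μ.restrict Ω] v)
    (h2 : g =ᵐ[μ.restrict Ω] h) : IsSobolevGradLoc μ p Ω v h := fun V hV hVc hVΩ =>
  (hu V hV hVc hVΩ).congr (ae_restrict_of_ae_restrict_of_subset (subset_closure.trans hVΩ) h1)
    (ae_restrict_of_ae_restrict_of_subset (subset_closure.trans hVΩ) h2)

/-! ### Test functions -/

/-- Multiplication by a cutoff equal to `1` on `K` changes `f` only at points off `K` where `f ≠ 0`.
In both uses such points lie outside the half-cylinder `G`, where the values are irrelevant. -/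
theorem exists_isTestFun_eq {O K : Set (E m)} (hO : IsOpen O) (hK : IsCompact K) (hKO : K ⊆ O)
    {f : E m → ℝ} (hf : ContDiffOn ℝ ∞ f O) :
    ∃ ψ, IsTestFun O ψ ∧ ∀ x, (x ∉ K → f x = 0) → ψ x = f x := by
  obtain ⟨V, hV, hKV, hVO, hVc⟩ := exists_open_between_and_isCompact_closure hK hO hKO
  obtain ⟨θ, h1, -, h2, h3⟩ := exists_contMDiff_support_eq_eq_one_iff (n := ⊤)
    (modelWithCornersSelf ℝ (E m)) hV hK.isClosed hKV
  have h4 : ContDiff ℝ ∞ θ := h1.contDiff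
  have h5 : tsupport θ = closure V := by rw [tsupport, h2]
  have h6 : tsupport (fun x => θ x * f x) ⊆ closure V := by
    rw [← h5]; exact closure_mono (Function.support_mul_subset_left _ _)
  refine ⟨fun x => θ x * f x, ⟨?_, hVc.of_isClosed_subset (isClosed_tsupport _) h6,
    h6.trans hVO⟩, fun x hx => ?_⟩
  · rw [← contDiffOn_univ]
    refine contDiffOn_mul_of_eq_zero isOpen_univ hO (isClosed_closure (s := V)).isOpen_compl ?_
      h4.contDiffOn (fun x _ hx => ?_) hf
    · intro x _
      by_cases hx : x ∈ closure V
      · exact Or.inl (hVO hx)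
      · exact Or.inr hx
    · exact image_eq_zero_of_notMem_tsupport (by rwa [h5])
  · by_cases h : x ∈ K
    · simp [(h3 x).1 h]
    · simp [hx h]

/-! ### The transformed operator -/

section Operator

variable {κ : ℝ} (hκ : 0 < κ) (A : E m → E m → E m)

include hκ

/-- This identity dictates the form of `pushOp`: the Jacobian factor of the change of variables
cancels, and `dT` moves to the other argument as its transpose. -/
theorem abs_det_smul_inner_pushOp (q r x : E m) :
    |(fderiv ℝ (T κ) x).det| • inner ℝ (pushOp κ A x q) r =
      inner ℝ (A x (ContinuousLinearMap.adjoint (fderiv ℝ (T κ) x) q))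
        (ContinuousLinearMap.adjoint (fderiv ℝ (T κ) x) r) := by
  rw [pushOp, real_inner_smul_left, smul_eq_mul, ← mul_assoc,
    mul_inv_cancel₀ (abs_ne_zero.2 (det_fderiv_T_ne_zero hκ x)), one_mul,
    ContinuousLinearMap.adjoint_inner_right]

theorem integrableOn_pushOp_iff {S : Set (E m)} (hS : MeasurableSet S) (q r : E m → E m) :
    IntegrableOn (fun ξ => inner ℝ (pushOp κ A (Tinv κ ξ) (q ξ)) (r ξ)) (T κ '' S) ↔
      IntegrableOn (fun x => inner ℝ
        (A x (ContinuousLinearMap.adjoint (fderiv ℝ (T κ) x) (q (T κ x))))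
        (ContinuousLinearMap.adjoint (fderiv ℝ (T κ) x) (r (T κ x)))) S := by
  rw [integrableOn_image_iff_integrableOn_abs_det_fderiv_smul volume hS
    (fun x _ => (differentiableAt_T κ x).hasFDerivAt.hasFDerivWithinAt) (T_injective hκ).injOn]
  simp only [Tinv_T hκ, abs_det_smul_inner_pushOp hκ]

theorem setIntegral_pushOp {S : Set (E m)} (hS : MeasurableSet S) (q r : E m → E m) :
    ∫ ξ in T κ '' S, inner ℝ (pushOp κ A (Tinv κ ξ) (q ξ)) (r ξ) =
      ∫ x in S, inner ℝ (A x (ContinuousLinearMap.adjoint (fderiv ℝ (T κ) x) (q (T κ x))))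
        (ContinuousLinearMap.adjoint (fderiv ℝ (T κ) x) (r (T κ x))) := by
  rw [integral_image_eq_integral_abs_det_fderiv_smul volume hS
    (fun x _ => (differentiableAt_T κ x).hasFDerivAt.hasFDerivWithinAt) (T_injective hκ).injOn]
  simp only [Tinv_T hκ, abs_det_smul_inner_pushOp hκ]

omit hκ in
theorem opB_of_pos {ξ : E m} (h : 0 < ht ξ) (q : E m) :
    opB κ A ξ q = pushOp κ A (Tinv κ ξ) q := by
  have h0 : ξ ≠ 0 := by rintro rfl; simp [ht] at h
  rw [opB, if_neg h0, if_pos h.le]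

omit hκ in
-- The condition `0 < ht ξ` excludes the hyperplane, where `opB` is given by the upper formula
-- alone; it is a null set.
theorem opB_P {ξ : E m} (h : 0 < ht ξ) (q : E m) :
    opB κ A (P ξ) (P q) = P (opB κ A ξ q) := by
  have h0 : P ξ ≠ 0 := by
    intro h1
    have h2 := congrArg ht h1
    rw [ht_P] at h2
    have h3 : ht (0 : E m) = 0 := rfl
    linarith
  have h1 : ¬ 0 ≤ ht (P ξ) := by rw [ht_P]; linarith
  rw [opB_of_pos A h, opB, if_neg h0, if_neg h1, P_P, P_P]

end Operator

/-! ### Integrals over a domain symmetric under `P`. -/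

theorem ae_eq_upper_union_lower {Ω : Set (E m)} (hP : ∀ ξ, P ξ ∈ Ω ↔ ξ ∈ Ω) :
    Ω =ᵐ[volume] ((Ω ∩ {ξ | 0 < ht ξ}) ∪ P ⁻¹' (Ω ∩ {ξ | 0 < ht ξ}) : Set (E m)) := by
  have h : ∀ᵐ ξ : E m, ht ξ ≠ 0 := by
    rw [ae_iff]; simpa using volume_ht_eq_zero (m := m)
  filter_upwards [h] with ξ hξ
  refine propext ?_
  change ξ ∈ Ω ↔ (ξ ∈ Ω ∧ 0 < ht ξ) ∨ (P ξ ∈ Ω ∧ 0 < ht (P ξ))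
  rw [hP, ht_P, neg_pos, ← and_or_left, or_comm]
  exact ⟨fun h => ⟨h, lt_or_gt_of_ne hξ⟩, fun h => h.1⟩

theorem measurableSet_upper {Ω : Set (E m)} (hΩ : MeasurableSet Ω) :
    MeasurableSet (Ω ∩ {ξ | 0 < ht ξ}) :=
  hΩ.inter (isOpen_lt continuous_const continuous_ht).measurableSet

theorem integrableOn_iff_upper {Ω : Set (E m)} (hP : ∀ ξ, P ξ ∈ Ω ↔ ξ ∈ Ω) {Φ : E m → ℝ} :
    IntegrableOn Φ Ω ↔ IntegrableOn Φ (Ω ∩ {ξ | 0 < ht ξ}) ∧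
      IntegrableOn (fun ξ => Φ (P ξ)) (Ω ∩ {ξ | 0 < ht ξ}) := by
  rw [integrableOn_congr_set_ae (ae_eq_upper_union_lower hP), integrableOn_union]
  have h := measurePreserving_P.integrableOn_comp_preimage (measurableEmbedding_P (m := m))
    (f := fun ξ => Φ (P ξ)) (s := Ω ∩ {ξ | 0 < ht ξ})
  simp only [Function.comp_def, P_P] at h
  rw [h]

theorem setIntegral_eq_upper {Ω : Set (E m)} (hΩ : MeasurableSet Ω)
    (hP : ∀ ξ, P ξ ∈ Ω ↔ ξ ∈ Ω) {Φ : E m → ℝ} (hΦ : IntegrableOn Φ Ω) :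
    ∫ ξ in Ω, Φ ξ = (∫ ξ in Ω ∩ {ξ | 0 < ht ξ}, Φ ξ) + ∫ ξ in Ω ∩ {ξ | 0 < ht ξ}, Φ (P ξ) := by
  have hae := ae_eq_upper_union_lower hP
  rw [integrableOn_congr_set_ae hae, integrableOn_union] at hΦ
  have h := measurePreserving_P.setIntegral_preimage_emb (measurableEmbedding_P (m := m))
    (fun ξ => Φ (P ξ)) (Ω ∩ {ξ | 0 < ht ξ})
  simp only [P_P] at h
  have hd : Disjoint (Ω ∩ {ξ | 0 < ht ξ}) (P ⁻¹' (Ω ∩ {ξ | 0 < ht ξ})) := by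
    rw [Set.disjoint_left]
    rintro ξ ⟨-, h1⟩ ⟨-, h2⟩
    simp only [Set.mem_ofPred_eq, ht_P] at h1 h2
    linarith
  rw [setIntegral_congr_set hae, setIntegral_union hd
    (continuous_P.measurable (measurableSet_upper hΩ)) hΦ.1 hΦ.2, h]

/-! ### Differential of the fold -/

/-- The linear map `(ξ', ξₙ) ↦ (ξ', s ξₙ)`. -/
def scaleLast (m : ℕ) (s : ℝ) : E m →L[ℝ] E m :=
  ContinuousLinearMap.id ℝ (E m) +
    (s - 1) • (EuclideanSpace.proj (𝕜 := ℝ) (ι := Fin (m + 1)) (Fin.last m)).smulRight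
      (pt (0 : EuclideanSpace ℝ (Fin m)) 1)

theorem ht_zero : ht (0 : E m) = 0 := rfl

theorem scaleLast_apply (s : ℝ) (x : E m) : scaleLast m s x = pt (hor x) (s * ht x) := by
  have h : scaleLast m s x = x + (s - 1) • (ht x • pt (0 : EuclideanSpace ℝ (Fin m)) 1) := rfl
  refine ext_hor_ht ?_ ?_
  · rw [h]; simp [hor_add, hor_smul]
  · rw [h]; simp [ht_add, ht_smul]; ring

theorem scaleLast_one : scaleLast m 1 = ContinuousLinearMap.id ℝ (E m) := by
  ext1 x; rw [scaleLast_apply]; simp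

theorem scaleLast_neg_one :
    scaleLast m (-1) = ((reflection m).toContinuousLinearEquiv : E m →L[ℝ] E m) := by
  ext1 x; rw [scaleLast_apply]; simp [P]

theorem continuous_scaleLast : Continuous (scaleLast m) := by
  unfold scaleLast; fun_prop

theorem exists_norm_scaleLast_le (m : ℕ) : ∃ C, ∀ s : ℝ, |s| ≤ 1 → ‖scaleLast m s‖ ≤ C := by
  obtain ⟨C, hC⟩ := (isCompact_Icc (a := (-1 : ℝ)) (b := 1)).exists_bound_of_continuousOn
    (continuous_scaleLast (m := m)).continuousOn
  exact ⟨C, fun s hs => hC s (abs_le.1 hs)⟩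

theorem hasFDerivAt_foldEps {ε : ℝ} (hε : 0 < ε) (ξ : E m) :
    HasFDerivAt (foldEps ε) (scaleLast m (ht ξ / √(ht ξ ^ 2 + ε ^ 2))) ξ := by
  have h1 : HasFDerivAt (ht : E m → ℝ)
      (EuclideanSpace.proj (𝕜 := ℝ) (ι := Fin (m + 1)) (Fin.last m)) ξ :=
    (EuclideanSpace.proj (𝕜 := ℝ) (ι := Fin (m + 1)) (Fin.last m)).hasFDerivAt
  -- `foldEps ε` is the identity plus the correction `√(t² + ε²) - t` in the last direction,
  -- matching the form of `scaleLast`.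
  have h2 : HasDerivAt (fun t : ℝ => √(t ^ 2 + ε ^ 2) - t)
      (ht ξ / √(ht ξ ^ 2 + ε ^ 2) - 1) (ht ξ) := by
    have h3 : HasDerivAt (fun t : ℝ => t ^ 2 + ε ^ 2) (2 * ht ξ) (ht ξ) := by
      simpa using ((hasDerivAt_id (ht ξ)).pow 2).add_const (ε ^ 2)
    have h4 := (h3.sqrt (by positivity)).sub (hasDerivAt_id (ht ξ))
    have h5 : ht ξ / √(ht ξ ^ 2 + ε ^ 2) = 2 * ht ξ / (2 * √(ht ξ ^ 2 + ε ^ 2)) :=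
      (mul_div_mul_left _ _ two_ne_zero).symm
    rw [h5]
    exact h4
  have h5 := ((hasFDerivAt_id (𝕜 := ℝ) ξ).add
    ((h2.comp_hasFDerivAt ξ h1).smul_const (pt (0 : EuclideanSpace ℝ (Fin m)) 1)))
  refine (h5.congr_of_eventuallyEq (Eventually.of_forall fun x => ?_)).congr_fderiv ?_
  · refine ext_hor_ht ?_ ?_
    · simp [hor_add, hor_smul]
    · simp [ht_add, ht_smul]
  · ext1 x
    simp [scaleLast, smul_smul]

/-- The transpose of the differential of `unfold κ`. -/
def unfoldDiff (κ : ℝ) (ξ : E m) : E m →L[ℝ] E m :=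
  ContinuousLinearMap.adjoint
    -- The quotient is the sign of `ξₙ`; its default value `0` on the hyperplane concerns a null set
    -- only.
    ((fderiv ℝ (Tinv κ) (fold ξ)).comp (scaleLast m (ht ξ / |ht ξ|)))

theorem unfoldDiff_of_pos (κ : ℝ) {ξ : E m} (h : 0 < ht ξ) :
    unfoldDiff κ ξ = ContinuousLinearMap.adjoint (fderiv ℝ (Tinv κ) ξ) := by
  rw [unfoldDiff, abs_of_pos h, div_self h.ne', scaleLast_one, fold_of_nonneg h.le,
    ContinuousLinearMap.comp_id]

theorem adjoint_reflection (q : E m) : ContinuousLinearMap.adjoint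
    ((reflection m).toContinuousLinearEquiv : E m →L[ℝ] E m) q = P q := by
  rw [← adjoint_fderiv_P 0 q, (hasFDerivAt_P 0).fderiv]

theorem unfoldDiff_P (κ : ℝ) {ξ : E m} (h : 0 < ht ξ) (q : E m) :
    unfoldDiff κ (P ξ) q = P (unfoldDiff κ ξ q) := by
  rw [unfoldDiff_of_pos κ h, unfoldDiff, ht_P, abs_neg, abs_of_pos h, neg_div, div_self h.ne',
    scaleLast_neg_one, fold_P, fold_of_nonneg h.le, ContinuousLinearMap.adjoint_comp,
    ContinuousLinearMap.comp_apply, adjoint_reflection]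

theorem adjoint_fderiv_T_unfoldDiff {κ : ℝ} (hκ : 0 < κ) {x : E m} (h : 0 < ht (T κ x)) (q : E m) :
    ContinuousLinearMap.adjoint (fderiv ℝ (T κ) x) (unfoldDiff κ (T κ x) q) = q := by
  rw [unfoldDiff_of_pos κ h, ← ContinuousLinearMap.comp_apply,
    ← ContinuousLinearMap.adjoint_comp, fderiv_Tinv_comp_fderiv_T hκ, ContinuousLinearMap.adjoint_id]
  rfl

theorem ae_ht_ne_zero (V : Set (E m)) : ∀ᵐ ξ ∂(volume.restrict V), ht ξ ≠ 0 :=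
  ae_restrict_of_ae (by rw [ae_iff]; simpa using volume_ht_eq_zero (m := m))

/-! ### From the cylinder to the ball: even reflection of a solution. -/

section Pullback

variable {κ : ℝ} (hκ : 0 < κ) {F : Set (E m)} (hF : IsClosed F) (hFG : F ⊆ closure (G m))
  (hb : base m ⊆ F)

include hκ hF hFG

/-- `unfold` is the limit of the smooth maps `Tinv ∘ foldEps`. Their differentials stay bounded,
because the slopes `ξₙ / √(ξₙ² + ε²)` lie in `[-1, 1]`, and converge off the hyperplane, so
`IsSobolevGrad.comp` applies. -/
theorem IsSobolevGradLoc.comp_unfold {p : ℝ} (hp : 1 ≤ p) {v : E m → ℝ} {g : E m → E m}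
    (hv : IsSobolevGradLoc volume p Fᶜ v g) :
    IsSobolevGradLoc volume p (D κ F) (fun ξ => v (unfold κ ξ))
      (fun ξ => unfoldDiff κ ξ (g (unfold κ ξ))) := by
  intro V hV hVc hVD
  have hV0 : closure V ⊆ {0}ᶜ := fun ξ hξ => ne_zero_of_mem_D hκ hFG (hVD hξ)
  have hfin : volume V ≠ ⊤ := ((measure_mono subset_closure).trans_lt hVc.measure_lt_top).ne
  have hL : IsCompact (unfold κ '' closure V) :=
    hVc.image_of_continuousOn ((continuousOn_unfold κ).mono hV0)
  have hLF : unfold κ '' closure V ⊆ Fᶜ := by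
    rintro _ ⟨ξ, hξ, rfl⟩
    exact (unfold_mem hκ hFG (hVD hξ)).2
  obtain ⟨W, hW, hLW, hWF, hWc⟩ :=
    exists_open_between_and_isCompact_closure hL hF.isOpen_compl hLF
  obtain ⟨c, hc, hmap⟩ := exists_map_unfold_le hκ hVc hV0
    (W := W) (fun ξ hξ => hLW ⟨ξ, hξ, rfl⟩)
  have hO : IsOpen (slit m ∩ Tinv κ ⁻¹' W) :=
    (contDiffOn_Tinv κ).continuousOn.isOpen_inter_preimage isOpen_slit hW
  have hN : IsCompact (fold '' closure V) := hVc.image continuous_fold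
  have hNO : fold '' closure V ⊆ slit m ∩ Tinv κ ⁻¹' W := by
    rintro _ ⟨ξ, hξ, rfl⟩
    exact ⟨mem_slit_fold (hV0 hξ), hLW ⟨ξ, hξ, rfl⟩⟩
  -- Room for the approximation: as `e k ≤ δ`, every `foldEps (e k)` sends `V` into the compact
  -- thickening `N`, on which `Tinv` is smooth with values in `W`.
  obtain ⟨δ, hδ, hδO⟩ := hN.exists_cthickening_subset_open hO hNO
  set N := Metric.cthickening δ (fold '' closure V) with hNdef
  have hNc : IsCompact N := hN.cthickening
  have hNs : N ⊆ slit m := fun ξ hξ => (hδO hξ).1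
  have hK : IsCompact (Tinv κ '' N) :=
    hNc.image_of_continuousOn ((contDiffOn_Tinv κ).continuousOn.mono hNs)
  have hKW : Tinv κ '' N ⊆ W := by
    rintro _ ⟨ξ, hξ, rfl⟩
    exact (hδO hξ).2
  set e : ℕ → ℝ := fun k => δ / (k + 1) with he
  have hepos : ∀ k, 0 < e k := fun k => by positivity
  have hele : ∀ k, e k ≤ δ := fun k => div_le_self hδ.le (by simp)
  have helim : Tendsto e atTop (𝓝 0) := by
    have h := (tendsto_one_div_add_atTop_nhds_zero_nat (𝕜 := ℝ)).const_mul δ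
    simpa [he, div_eq_mul_inv] using h
  have hmapsN : ∀ k, ∀ ξ ∈ V, foldEps (e k) ξ ∈ N := fun k ξ hξ =>
    Metric.mem_cthickening_of_dist_le _ (fold ξ) _ _ ⟨ξ, subset_closure hξ, rfl⟩
      ((dist_foldEps_fold (hepos k) ξ).trans (hele k))
  have hfd : ContinuousOn (fderiv ℝ (Tinv κ : E m → E m)) (slit m) :=
    (contDiffOn_Tinv κ).continuousOn_fderiv_of_isOpen isOpen_slit (by simp)
  obtain ⟨C₁, hC₁⟩ := hNc.exists_bound_of_continuousOn (hfd.mono hNs)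
  obtain ⟨C₂, hC₂⟩ := exists_norm_scaleLast_le m
  have hderiv : ∀ k, ∀ ξ ∈ V, fderiv ℝ (fun ξ => Tinv κ (foldEps (e k) ξ)) ξ =
      (fderiv ℝ (Tinv κ) (foldEps (e k) ξ)).comp
        (scaleLast m (ht ξ / √(ht ξ ^ 2 + e k ^ 2))) := fun k ξ hξ =>
    ((differentiableAt_Tinv κ (hNs (hmapsN k ξ hξ))).hasFDerivAt.comp ξ
      (hasFDerivAt_foldEps (hepos k) ξ)).fderiv
  refine (hv W hW hWc hWF).comp hp hV hfin hW hK hKW (measurable_unfold κ) hc hmap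
    (τs := fun k ξ => Tinv κ (foldEps (e k) ξ)) (M := unfoldDiff κ) (C := C₁ * C₂) ?_ ?_ ?_ ?_ ?_
  · exact fun k => (contDiffOn_Tinv κ).comp (contDiff_foldEps (hepos k)).contDiffOn
      fun ξ hξ => hNs (hmapsN k ξ hξ)
  · exact fun k ξ hξ => ⟨_, hmapsN k ξ hξ, rfl⟩
  · intro ξ hξ
    exact ((contDiffAt_Tinv κ (mem_slit_fold (hV0 (subset_closure hξ)))).continuousAt.tendsto).comp
      (tendsto_foldEps hepos helim ξ)
  · intro k ξ hξ
    rw [hderiv k ξ hξ]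
    refine (ContinuousLinearMap.opNorm_comp_le _ _).trans ?_
    have h1 := hC₁ _ (hmapsN k ξ hξ)
    refine mul_le_mul h1 (hC₂ _ ?_) (norm_nonneg _) ((norm_nonneg _).trans h1)
    rw [abs_div, abs_of_nonneg (Real.sqrt_nonneg _)]
    exact div_le_one_of_le₀ (Real.abs_le_sqrt (by nlinarith [hepos k])) (Real.sqrt_nonneg _)
  · filter_upwards [ae_ht_ne_zero V, ae_restrict_mem hV.measurableSet] with ξ h0 hξ
    refine (ContinuousLinearMap.adjoint (𝕜 := ℝ) (E := E m) (F := E m)).continuous.tendsto _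
      |>.comp ?_
    have h1 : Tendsto (fun k => fderiv ℝ (Tinv κ) (foldEps (e k) ξ)) atTop
        (𝓝 (fderiv ℝ (Tinv κ) (fold ξ))) :=
      (hfd.continuousAt (isOpen_slit.mem_nhds (mem_slit_fold (hV0 (subset_closure hξ))))).tendsto
        |>.comp (tendsto_foldEps hepos helim ξ)
    have h2 : Tendsto (fun k => ht ξ / √(ht ξ ^ 2 + e k ^ 2)) atTop (𝓝 (ht ξ / |ht ξ|)) := by
      have h3 : Tendsto (fun k => √(ht ξ ^ 2 + e k ^ 2)) atTop (𝓝 |ht ξ|) := by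
        have h4 := ((helim.pow 2).const_add (ht ξ ^ 2)).sqrt
        simpa [Real.sqrt_sq_eq_abs] using h4
      exact tendsto_const_nhds.div h3 (abs_ne_zero.2 h0)
    have h5 := (continuous_scaleLast (m := m)).tendsto _ |>.comp h2
    have h6 := (isBoundedBilinearMap_comp (𝕜 := ℝ) (E := E m) (F := E m) (G := E m)).continuous.tendsto
      (fderiv ℝ (Tinv κ) (fold ξ), scaleLast m (ht ξ / |ht ξ|)) |>.comp (h1.prodMk_nhds h5)
    exact h6.congr fun k => (hderiv k ξ hξ).symm

/-- The exceptional set lies in the union of the hyperplane, the `T`-image of a null set and the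
mirror image of the latter. Off the hyperplane `unfold κ ξ` is in the open cylinder, so nothing is
needed on the lateral boundary. -/
theorem ae_D_of_ae_G {q : E m → Prop} (h : ∀ᵐ x ∂(volume.restrict (G m \ F)), q x) :
    ∀ᵐ ξ ∂(volume.restrict (D κ F)), q (unfold κ ξ) := by
  have hD := (isOpen_D hκ hF hFG).measurableSet
  rw [ae_restrict_iff' (isOpen_G.measurableSet.diff hF.measurableSet), ae_iff] at h
  set N := {x | ¬ (x ∈ G m \ F → q x)} with hN
  have h1 : volume (T κ '' N) = 0 := addHaar_image_eq_zero_of_differentiableOn_of_addHaar_eq_zero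
    volume (fun x _ => (differentiableAt_T κ x).differentiableWithinAt) h
  have h2 : volume (P ⁻¹' (T κ '' N)) = 0 := by
    rw [measurePreserving_P.measure_preimage_emb measurableEmbedding_P, h1]
  have h3 : ∀ᵐ ξ, ξ ∉ T κ '' N := measure_eq_zero_iff_ae_notMem.1 h1
  have h4 : ∀ᵐ ξ, ξ ∉ P ⁻¹' (T κ '' N) := measure_eq_zero_iff_ae_notMem.1 h2
  filter_upwards [ae_restrict_of_ae h3, ae_restrict_of_ae h4, ae_restrict_mem hD,
    ae_ht_ne_zero (D κ F)] with ξ h5 h6 h7 h8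
  by_contra hq
  have h0 := ne_zero_of_mem_D hκ hFG h7
  have hmem := unfold_mem hκ hFG h7
  have h9 : unfold κ ξ ∈ N := by
    refine fun hi => hq (hi ⟨⟨?_, ?_⟩, hmem.2⟩)
    · rw [← ht_T_pos_iff κ, T_unfold hκ h0]; simpa using h8
    · refine ht_pos_of_T_mem_D hκ hFG (F := F) ?_
      rwa [T_unfold hκ h0, fold_mem_D hκ hFG]
  have h10 : fold ξ ∈ T κ '' N := ⟨_, h9, T_unfold hκ h0⟩
  rcases le_total 0 (ht ξ) with hh | hh
  · rw [fold_of_nonneg hh] at h10; exact h5 h10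
  · rw [fold_of_nonpos hh] at h10; exact h6 h10

include hb

/-- The equation on the cylinder is tested with `ψ ∘ T`, suitably cut off. It need not vanish on the
lateral boundary, which is what the zero conormal condition permits; hence the upper half
contributes zero by itself. -/
theorem upper_integral_eq_zero {A : E m → E m → E m} {g : E m → E m}
    (hg : ∀ φ : E m → ℝ, IsTestFun Fᶜ φ →
      IntegrableOn (fun x => inner ℝ (A x (g x)) (gradient φ x)) (G m \ F) ∧
      ∫ x in G m \ F, inner ℝ (A x (g x)) (gradient φ x) = 0)
    {ψ : E m → ℝ} (hψ : IsTestFun (D κ F) ψ) :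
    IntegrableOn (fun ξ => inner ℝ (opB κ A ξ (unfoldDiff κ ξ (g (unfold κ ξ)))) (gradient ψ ξ))
      (D κ F ∩ {ξ | 0 < ht ξ}) ∧
    ∫ ξ in D κ F ∩ {ξ | 0 < ht ξ},
      inner ℝ (opB κ A ξ (unfoldDiff κ ξ (g (unfold κ ξ)))) (gradient ψ ξ) = 0 := by
  obtain ⟨h1, h2, h3⟩ := hψ
  have hD := isOpen_D hκ hF hFG
  have hS : MeasurableSet (G m \ F) := isOpen_G.measurableSet.diff hF.measurableSet
  have hU : MeasurableSet (D κ F ∩ {ξ | 0 < ht ξ}) := measurableSet_upper hD.measurableSet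
  -- `ψ ∘ T` may fail to have compact support, since the support of `ψ` may meet the half-line
  -- omitted by `T`. The part with `ξₙ ≥ 0` stays away from that half-line and is all that `G` sees.
  have hK0 : tsupport ψ ∩ {ξ | 0 ≤ ht ξ} ⊆ slit m := fun ξ hξ =>
    mem_slit_of_nonneg hξ.2 (ne_zero_of_mem_D hκ hFG (h3 hξ.1))
  have hK : IsCompact (Tinv κ '' (tsupport ψ ∩ {ξ | 0 ≤ ht ξ})) :=
    (IsCompact.inter_right h2 (isClosed_le continuous_const continuous_ht)).image_of_continuousOn
      ((contDiffOn_Tinv κ).continuousOn.mono hK0)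
  have hO : IsOpen (T κ ⁻¹' D κ F) := hD.preimage (continuous_T κ)
  have hKO : Tinv κ '' (tsupport ψ ∩ {ξ | 0 ≤ ht ξ}) ⊆ T κ ⁻¹' D κ F := by
    rintro _ ⟨ξ, hξ, rfl⟩
    rw [Set.mem_preimage, T_Tinv_slit hκ (hK0 hξ)]
    exact h3 hξ.1
  obtain ⟨φ, ⟨hφ1, hφ2, hφ3⟩, hφ⟩ := exists_isTestFun_eq hO hK hKO
    (h1.comp (contDiff_T κ)).contDiffOn
  have hφF : IsTestFun Fᶜ φ := ⟨hφ1, hφ2, fun x hx => notMem_of_T_mem_D hκ hFG (hφ3 hx)⟩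
  have hφeq : ∀ x ∈ G m, φ x = ψ (T κ x) := by
    intro x hx
    refine hφ x fun hxK => ?_
    by_contra hne
    refine hxK ⟨T κ x, ⟨subset_tsupport _ hne, ?_⟩, Tinv_T hκ x⟩
    exact (ht_T_nonneg_iff κ x).2 hx.1.le
  have hgr : ∀ x ∈ G m, ContinuousLinearMap.adjoint (fderiv ℝ (T κ) x) (gradient ψ (T κ x)) =
      gradient φ x := by
    intro x hx
    rw [← gradient_comp (h1.differentiable (by simp) _) (differentiableAt_T κ x)]
    refine gradient_congr ?_
    filter_upwards [isOpen_G.mem_nhds hx] with y hy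
    exact (hφeq y hy).symm
  have hcongr : Set.EqOn (fun ξ => inner ℝ (opB κ A ξ (unfoldDiff κ ξ (g (unfold κ ξ))))
      (gradient ψ ξ)) (fun ξ => inner ℝ (pushOp κ A (Tinv κ ξ) (unfoldDiff κ ξ (g (unfold κ ξ))))
      (gradient ψ ξ)) (D κ F ∩ {ξ | 0 < ht ξ}) := fun ξ hξ => by
    simp only [opB_of_pos A hξ.2]
  have hcongr' : Set.EqOn (fun x => inner ℝ
      (A x (ContinuousLinearMap.adjoint (fderiv ℝ (T κ) x)
        (unfoldDiff κ (T κ x) (g (unfold κ (T κ x))))))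
      (ContinuousLinearMap.adjoint (fderiv ℝ (T κ) x) (gradient ψ (T κ x))))
      (fun x => inner ℝ (A x (g x)) (gradient φ x)) (G m \ F) := fun x hx => by
    simp only [unfold_T hκ hx.1.1.le, hgr x hx.1,
      adjoint_fderiv_T_unfoldDiff hκ ((ht_T_pos_iff κ x).2 hx.1.1)]
  have hmain := hg φ hφF
  rw [integrableOn_congr_fun hcongr hU, setIntegral_congr_fun hU hcongr,
    ← T_image_G_diff hκ hF hFG hb,
    integrableOn_pushOp_iff hκ A hS (fun ξ => unfoldDiff κ ξ (g (unfold κ ξ))) (gradient ψ),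
    setIntegral_pushOp hκ A hS (fun ξ => unfoldDiff κ ξ (g (unfold κ ξ))) (gradient ψ),
    integrableOn_congr_fun hcongr' hS, setIntegral_congr_fun hS hcongr']
  exact hmain

theorem isWeakSol_reflect {p : ℝ} (hp : 1 ≤ p) {A : E m → E m → E m} {u : E m → ℝ}
    (hu : IsMixedWeakSol p A F u) :
    IsWeakSol p (opB κ A) (D κ F) (reflect κ u) := by
  obtain ⟨v, g, huv, hv, hg⟩ := hu
  have hD := isOpen_D hκ hF hFG
  have hD0 : ∀ ξ ∈ D κ F, ξ ≠ 0 := fun ξ h => ne_zero_of_mem_D hκ hFG h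
  have hDP : ∀ ξ, P ξ ∈ D κ F ↔ ξ ∈ D κ F := fun ξ => P_mem_D hκ hFG
  refine ⟨fun ξ => unfoldDiff κ ξ (g (unfold κ ξ)), ?_, fun φ hφ => ?_⟩
  · rw [isSobolevGradLoc_wMeasure_iff hD0]
    refine (hv.comp_unfold hκ hF hFG hp).congr ?_ (ae_eq_refl _)
    have h1 : ∀ᵐ x ∂(volume.restrict (G m \ F)), u x = v x :=
      ae_restrict_of_ae_restrict_of_subset (Set.sdiff_subset_sdiff_left subset_closure) huv
    filter_upwards [ae_D_of_ae_G hκ hF hFG h1] with ξ hξ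
    rw [reflect_eq, hξ]
  · have h1 := upper_integral_eq_zero hκ hF hFG hb hg hφ
    -- The lower half of the integral for `φ` is the upper half for `φ ∘ P`, by the symmetry of the
    -- operator and of the reflected gradient.
    have hφP : IsTestFun (D κ F) (fun ξ => φ (P ξ)) := by
      refine ⟨hφ.1.comp contDiff_P,
        hφ.2.1.comp_homeomorph (reflection m).toHomeomorph, fun ξ hξ => ?_⟩
      rw [← hDP]
      exact hφ.2.2 (tsupport_comp_subset_preimage φ continuous_P hξ)
    have h2 := upper_integral_eq_zero hκ hF hFG hb hg hφP
    have hcongr : Set.EqOn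
        (fun ξ => inner ℝ (opB κ A (P ξ) (unfoldDiff κ (P ξ) (g (unfold κ (P ξ)))))
          (gradient φ (P ξ)))
        (fun ξ => inner ℝ (opB κ A ξ (unfoldDiff κ ξ (g (unfold κ ξ))))
          (gradient (fun ξ => φ (P ξ)) ξ)) (D κ F ∩ {ξ | 0 < ht ξ}) := by
      intro ξ hξ
      simp only
      rw [unfold_P, unfoldDiff_P κ hξ.2, opB_P A hξ.2,
        gradient_comp (hφ.1.differentiable (by simp) _) (hasFDerivAt_P ξ).differentiableAt,
        adjoint_fderiv_P, inner_P_left]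
    have hU : MeasurableSet (D κ F ∩ {ξ | 0 < ht ξ}) := measurableSet_upper hD.measurableSet
    have h3 : IntegrableOn (fun ξ => inner ℝ (opB κ A ξ (unfoldDiff κ ξ (g (unfold κ ξ))))
        (gradient φ ξ)) (D κ F) := by
      rw [integrableOn_iff_upper hDP, integrableOn_congr_fun hcongr hU]
      exact ⟨h1.1, h2.1⟩
    refine ⟨h3, ?_⟩
    rw [setIntegral_eq_upper hD.measurableSet hDP h3, setIntegral_congr_fun hU hcongr, h1.2, h2.2,
      add_zero]

end Pullback

/-! ### Growth of the operators. -/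

/-- In `IsElliptic` the exceptional null set may depend on `q`. Countably many dense `q` share one
null set, and continuity in `q` extends the bound to all `q`. -/
theorem IsElliptic.exists_bound {p : ℝ} (hp : 1 < p) {A : E m → E m → E m} (hA : IsElliptic p A) :
    ∃ α : ℝ, 0 < α ∧ ∀ᵐ x ∂(volume.restrict (G m)), ∀ q, ‖A x q‖ ≤ α * ‖q‖ ^ (p - 1) := by
  obtain ⟨α₁, α, h1, h2, -, h3⟩ := hA.bounds
  refine ⟨α, h1.trans_le h2, ?_⟩
  have h4 : ∀ᵐ x ∂(volume.restrict (closure (G m))), ∀ k : ℕ,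
      ‖A x (TopologicalSpace.denseSeq (E m) k)‖ ≤
        α * ‖TopologicalSpace.denseSeq (E m) k‖ ^ (p - 1) := ae_all_iff.2 fun k => h3 _
  filter_upwards [ae_restrict_of_ae_restrict_of_subset subset_closure h4,
    ae_restrict_of_ae_restrict_of_subset subset_closure hA.continuous] with x h5 h6 q
  refine (TopologicalSpace.denseRange_denseSeq (E m)).induction_on
    (p := fun q => ‖A x q‖ ≤ α * ‖q‖ ^ (p - 1)) q ?_ h5
  exact isClosed_le h6.norm
    (continuous_const.mul (continuous_norm.rpow_const fun _ => Or.inr (by linarith)))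

theorem norm_pushOp_le {p : ℝ} (hp : 1 < p) {κ α : ℝ} (hα : 0 < α) {A : E m → E m → E m} {x : E m}
    (hA : ∀ q, ‖A x q‖ ≤ α * ‖q‖ ^ (p - 1)) (q : E m) :
    ‖pushOp κ A x q‖ ≤ |(fderiv ℝ (T κ) x).det|⁻¹ * (‖fderiv ℝ (T κ) x‖ *
      (α * ‖fderiv ℝ (T κ) x‖ ^ (p - 1))) * ‖q‖ ^ (p - 1) := by
  rw [pushOp, norm_smul, norm_inv, Real.norm_eq_abs, abs_abs, mul_assoc]
  refine mul_le_mul_of_nonneg_left ?_ (inv_nonneg.2 (abs_nonneg _))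
  refine (ContinuousLinearMap.le_opNorm _ _).trans ?_
  rw [mul_assoc]
  refine mul_le_mul_of_nonneg_left ((hA _).trans ?_) (norm_nonneg _)
  rw [mul_assoc, ← Real.mul_rpow (norm_nonneg _) (norm_nonneg _)]
  refine mul_le_mul_of_nonneg_left (Real.rpow_le_rpow (norm_nonneg _) ?_ (by linarith)) hα.le
  refine (ContinuousLinearMap.le_opNorm _ _).trans_eq ?_
  rw [LinearIsometryEquiv.norm_map]

/-- Turns growth of order `p - 1` into the locally integrable majorant `1 + ‖g‖ ^ p`. -/
theorem rpow_sub_one_le {p t : ℝ} (hp : 1 < p) (ht : 0 ≤ t) : t ^ (p - 1) ≤ 1 + t ^ p := by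
  rcases le_total t 1 with h | h
  · exact (Real.rpow_le_one ht h (by linarith)).trans (by linarith [Real.rpow_nonneg ht p])
  · exact (Real.rpow_le_rpow_of_exponent_le h (sub_le_self p zero_le_one)).trans (by linarith)

section Converse

variable {κ : ℝ} (hκ : 0 < κ) {F : Set (E m)} (hF : IsClosed F) (hFG : F ⊆ closure (G m))
  (hb : base m ⊆ F)

include hκ hF hFG

/-! ### Symmetry of the gradient -/

theorem IsSobolevGradLoc.comp_P {p : ℝ} (hp : 1 ≤ p) {u : E m → ℝ} {g : E m → E m}
    (hu : IsSobolevGradLoc volume p (D κ F) u g) :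
    IsSobolevGradLoc volume p (D κ F) (fun ξ => u (P ξ)) (fun ξ => P (g (P ξ))) := by
  intro V hV hVc hVD
  have hfin : volume V ≠ ⊤ := ((measure_mono subset_closure).trans_lt hVc.measure_lt_top).ne
  have hK : IsCompact (P '' closure V) := hVc.image continuous_P
  have hKD : P '' closure V ⊆ D κ F := by
    rintro _ ⟨ξ, hξ, rfl⟩
    exact (P_mem_D hκ hFG).2 (hVD hξ)
  obtain ⟨W, hW, hKW, hWD, hWc⟩ :=
    exists_open_between_and_isCompact_closure hK (isOpen_D hκ hF hFG) hKD
  have hmap : (volume.restrict V).map P ≤ (1 : ℝ≥0∞) • volume.restrict W := by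
    rw [one_smul]
    refine Measure.le_iff.2 fun s hs => ?_
    rw [Measure.map_apply continuous_P.measurable hs,
      Measure.restrict_apply (continuous_P.measurable hs), Measure.restrict_apply hs,
      ← measurePreserving_P.measure_preimage_emb measurableEmbedding_P (s ∩ W)]
    exact measure_mono fun ξ hξ => ⟨hξ.1, hKW ⟨ξ, subset_closure hξ.2, rfl⟩⟩
  have h := (hu W hW hWc hWD).comp hp hV hfin hW hK hKW continuous_P.measurable ENNReal.one_ne_top
    hmap (τs := fun _ => P) (M := fun x => ContinuousLinearMap.adjoint (fderiv ℝ P x))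
    (C := ‖((reflection m).toContinuousLinearEquiv : E m →L[ℝ] E m)‖)
    (fun _ => contDiff_P.contDiffOn) (fun _ ξ hξ => ⟨ξ, subset_closure hξ, rfl⟩)
    (fun _ _ => tendsto_const_nhds) (fun _ ξ _ => by rw [(hasFDerivAt_P ξ).fderiv])
    (Eventually.of_forall fun _ => tendsto_const_nhds)
  simpa only [adjoint_fderiv_P] using h

/-- The field `g` and its reflection are gradients of a.e. equal functions. -/
theorem IsSobolevGradLoc.gradient_even {p : ℝ} (hp : 1 ≤ p) {u : E m → ℝ} {g : E m → E m}
    (hu : IsSobolevGradLoc volume p (D κ F) u g)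
    (heven : ∀ᵐ ξ ∂(volume.restrict (D κ F)), u (P ξ) = u ξ) :
    ∀ᵐ ξ ∂(volume.restrict (D κ F)), g (P ξ) = P (g ξ) := by
  filter_upwards [(hu.comp_P hκ hF hFG hp).gradient_unique hp (isOpen_D hκ hF hFG) hu heven]
    with ξ hξ
  rw [← hξ, P_P]

/-! ### Extension of the pulled back function -/

include hb

/-- `u ∘ T` is controlled only on `O = T⁻¹(D)`, whereas membership in the local space asks for an
extension to `Fᶜ`. The set `A = closedCyl m \ F` is closed relative to `Fᶜ` and lies in `O`, so it
can be separated from `Oᶜ`. The cutoff is `f / (f + h)`, where `f` is positive exactly where `2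
dist(x, A) < dist(x, Oᶜ)` and `h` exactly off the closed cylinder; on `Fᶜ` they have no common zero.
-/
theorem exists_cutoff : ∃ (χ : E m → ℝ) (C : Set (E m)), ContDiffOn ℝ ∞ χ Fᶜ ∧
    (∀ x ∈ closedCyl m, x ∉ F → χ x = 1) ∧ IsClosed C ∧ (∀ x ∉ C, χ x = 0) ∧
    ∀ x ∈ C, x ∉ F → T κ x ∈ D κ F := by
  set A : Set (E m) := closedCyl m \ F with hAdef
  set O : Set (E m) := T κ ⁻¹' D κ F with hOdef
  have hO : IsOpen O := (isOpen_D hκ hF hFG).preimage (continuous_T κ)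
  have hAO : A ⊆ O := fun x hx => T_mem_D hκ hF hFG hb hx.1 hx.2
  -- `Metric.infDist` to the empty set is `0` by convention, so distances are usable only once `A`
  -- and `Oᶜ` are nonempty.
  rcases A.eq_empty_or_nonempty with hA | hA
  · refine ⟨fun _ => 0, ∅, contDiffOn_const, fun x h1 h2 => ?_, isClosed_empty, fun _ _ => rfl,
      fun x hx => hx.elim⟩
    exact absurd (show x ∈ A from ⟨h1, h2⟩) (by simp [hA])
  -- The origin has height zero, and `T` sends it to the unit sphere.
  have hOc : (Oᶜ).Nonempty := ⟨0, fun h => by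
    have h1 := ht_pos_of_T_mem_D hκ hFG (show T κ 0 ∈ D κ F from h)
    simp [ht_zero] at h1⟩
  have hcA : Continuous fun x : E m => 2 * Metric.infDist x A :=
    continuous_const.mul (Metric.continuous_infDist_pt A)
  have hcO : Continuous fun x : E m => Metric.infDist x Oᶜ := Metric.continuous_infDist_pt _
  obtain ⟨f, hf1, hf2, hf3⟩ := (isOpen_lt hcA hcO).exists_contDiff_support_eq (n := ⊤)
  obtain ⟨h, hh1, hh2, hh3⟩ :=
    (isClosed_closedCyl (m := m)).isOpen_compl.exists_contDiff_support_eq (n := ⊤)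
  have hfnn : ∀ x, 0 ≤ f x := fun x => (hf3 ⟨x, rfl⟩).1
  have hhnn : ∀ x, 0 ≤ h x := fun x => (hh3 ⟨x, rfl⟩).1
  have hfA : ∀ x ∈ A, f x ≠ 0 := fun x hx => by
    rw [← Function.mem_support, hf1]
    change 2 * Metric.infDist x A < Metric.infDist x Oᶜ
    rw [Metric.infDist_zero_of_mem hx, mul_zero]
    exact (hO.isClosed_compl.notMem_iff_infDist_pos hOc).1 fun h => h (hAO hx)
  have hhA : ∀ x ∈ closedCyl m, h x = 0 := fun x hx => by
    by_contra hne
    rw [← ne_eq, ← Function.mem_support, hh1] at hne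
    exact hne hx
  have hne : ∀ x ∈ Fᶜ, f x + h x ≠ 0 := by
    intro x hx
    by_cases hxc : x ∈ closedCyl m
    · rw [hhA x hxc, add_zero]; exact hfA x ⟨hxc, hx⟩
    · have h1 : h x ≠ 0 := by rw [← Function.mem_support, hh1]; exact hxc
      have h2 := lt_of_le_of_ne (hhnn x) h1.symm
      have h3 := hfnn x
      positivity
  refine ⟨fun x => f x / (f x + h x), {x | 2 * Metric.infDist x A ≤ Metric.infDist x Oᶜ}, ?_, ?_,
    isClosed_le hcA hcO, ?_, ?_⟩
  · exact hf2.contDiffOn.div (hf2.add hh2).contDiffOn hne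
  · intro x hx hxF
    simp only [hhA x hx, add_zero, div_self (hfA x ⟨hx, hxF⟩)]
  · intro x hx
    have h1 : f x = 0 := by
      by_contra hne
      rw [← ne_eq, ← Function.mem_support, hf1] at hne
      exact hx (Set.mem_ofPred.2 (le_of_lt (Set.mem_ofPred.1 hne)))
    simp only [h1, zero_div]
  · intro x hx hxF
    -- A point of `C \ F` outside `O` has distance zero to `A`, so it lies in the closed cylinder
    -- and off `F`, that is in `A ⊆ O`.
    by_contra hxO
    have h1 : Metric.infDist x Oᶜ = 0 := Metric.infDist_zero_of_mem hxO
    have h2 : 2 * Metric.infDist x A ≤ Metric.infDist x Oᶜ := hx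
    have h3 : Metric.infDist x A = 0 := by linarith [Metric.infDist_nonneg (x := x) (s := A)]
    have h4 : x ∈ closure A := (Metric.mem_closure_iff_infDist_zero hA).2 h3
    have h5 : x ∈ closedCyl m :=
      closure_minimal Set.sdiff_subset isClosed_closedCyl h4
    exact hxO (hAO ⟨h5, hxF⟩)

/-- The extension is `χ · (u ∘ T)`. As `χ` is identically `1` on the open set `G m \ F`, no
derivative of `χ` appears there. -/
theorem exists_extension {p : ℝ} (hp : 1 ≤ p) {u : E m → ℝ} {g : E m → E m}
    (hu : IsSobolevGradLoc volume p (D κ F) u g) :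
    ∃ (v : E m → ℝ) (h : E m → E m), IsSobolevGradLoc volume p Fᶜ v h ∧
      (∀ x ∈ closedCyl m, x ∉ F → v x = u (T κ x)) ∧
      ∀ x ∈ G m, x ∉ F → h x = ContinuousLinearMap.adjoint (fderiv ℝ (T κ) x) (g (T κ x)) := by
  obtain ⟨χ, C, hχ, hχ1, hC, hχ0, hCD⟩ := exists_cutoff hκ hF hFG hb
  have hD := isOpen_D hκ hF hFG
  have hO : IsOpen (T κ ⁻¹' D κ F) := hD.preimage (continuous_T κ)
  refine ⟨fun x => χ x * u (T κ x), fun x =>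
    χ x • ContinuousLinearMap.adjoint (fderiv ℝ (T κ) x) (g (T κ x)) +
      u (T κ x) • gradient χ x, ?_, ?_, ?_⟩
  · intro V hV hVc hVF
    -- Only a neighbourhood of `closure V ∩ C` matters, since `χ` vanishes off `C`; this
    -- intersection is compact and lies in `T⁻¹(D)`.
    obtain ⟨W₀, hW₀, hKW₀, hW₀O, hW₀c⟩ := exists_open_between_and_isCompact_closure
      (hVc.inter_right hC) hO fun x hx => hCD x hx.2 (hVF hx.1)
    have hK : IsCompact (T κ '' closure W₀) := hW₀c.image (continuous_T κ)
    obtain ⟨W, hW, hKW, hWD, hWc⟩ := exists_open_between_and_isCompact_closure hK hD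
      (by rintro _ ⟨x, hx, rfl⟩; exact hW₀O hx)
    have hV1 : IsOpen (V ∩ W₀) := hV.inter hW₀
    have hV1c : IsCompact (closure (V ∩ W₀)) :=
      hVc.of_isClosed_subset isClosed_closure (closure_mono Set.inter_subset_left)
    have hfin : volume (V ∩ W₀) ≠ ⊤ :=
      ((measure_mono subset_closure).trans_lt hV1c.measure_lt_top).ne
    obtain ⟨c, hc, hmap⟩ := exists_map_T_le hκ hV1.measurableSet hV1c (W := W)
      fun x hx => hKW ⟨x, subset_closure hx.2, rfl⟩
    obtain ⟨C₁, hC₁⟩ := hV1c.exists_bound_of_continuousOn (continuous_fderiv_T κ).continuousOn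
    obtain ⟨C₂, hC₂⟩ := hVc.exists_bound_of_continuousOn (hχ.continuousOn.mono hVF)
    obtain ⟨C₃, hC₃⟩ := hVc.exists_bound_of_continuousOn
      ((continuousOn_gradient hF.isOpen_compl hχ).mono hVF)
    have h1 := (hu W hW hWc hWD).comp hp hV1 hfin hW hK hKW (continuous_T κ).measurable hc hmap
      (τs := fun _ => T κ) (M := fun x => ContinuousLinearMap.adjoint (fderiv ℝ (T κ) x))
      (C := C₁) (fun _ => (contDiff_T κ).contDiffOn) (fun _ x hx => ⟨x, subset_closure hx.2, rfl⟩)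
      (fun _ _ => tendsto_const_nhds) (fun _ x hx => hC₁ x (subset_closure hx))
      (Eventually.of_forall fun _ => tendsto_const_nhds)
    refine h1.cutoff hp hV hV1 hC.isOpen_compl Set.inter_subset_left (fun x hx => ?_)
      (hχ.mono (subset_closure.trans hVF)) (fun x _ hx => hχ0 x hx) (C := max C₂ C₃)
      (fun x hx => (hC₂ x (subset_closure hx)).trans (le_max_left _ _))
      (fun x hx => (hC₃ x (subset_closure hx)).trans (le_max_right _ _))
    by_cases hxC : x ∈ C
    · exact Or.inl ⟨hx, hKW₀ ⟨subset_closure hx, hxC⟩⟩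
    · exact Or.inr hxC
  · intro x hx hxF
    simp only [hχ1 x hx hxF, one_mul]
  · intro x hx hxF
    have h1 : χ =ᶠ[𝓝 x] fun _ => (1 : ℝ) := by
      filter_upwards [isOpen_G.mem_nhds hx, hF.isOpen_compl.mem_nhds hxF] with y hy hyF
      exact hχ1 y (G_subset_closedCyl hy) hyF
    simp only [gradient_congr h1, gradient_fun_const, hχ1 x (G_subset_closedCyl hx) hxF, one_smul,
      smul_zero, add_zero]

/-! ### The weak equation -/

omit hF hb in
-- The majorant for dominated convergence: on a compact subset of `D` the factors introduced by
-- `pushOp` are bounded, and `‖g‖ ^ p` is integrable.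
theorem exists_integrable_bound {p : ℝ} (hp : 1 < p) {A : E m → E m → E m} (hA : IsElliptic p A)
    (hD : IsOpen (D κ F)) (hF : IsClosed F) {u : E m → ℝ} {g : E m → E m}
    (hu : IsSobolevGradLoc volume p (D κ F) u g)
    {K : Set (E m)} (hK : IsCompact K) (hKD : K ⊆ D κ F) :
    ∃ b : E m → ℝ, Integrable b ∧ (∀ ξ, 0 ≤ b ξ) ∧
      ∀ᵐ ξ ∂(volume.restrict (D κ F ∩ {ξ | 0 < ht ξ})), ξ ∈ K → ‖opB κ A ξ (g ξ)‖ ≤ b ξ := by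
  obtain ⟨α, hα, hAα⟩ := hA.exists_bound hp
  have hKu : IsCompact (unfold κ '' K) := hK.image_of_continuousOn
    ((continuousOn_unfold κ).mono fun ξ hξ => ne_zero_of_mem_D hκ hFG (hKD hξ))
  have hcont : Continuous fun x : E m => |(fderiv ℝ (T κ) x).det|⁻¹ * (‖fderiv ℝ (T κ) x‖ *
      (α * ‖fderiv ℝ (T κ) x‖ ^ (p - 1))) := by
    refine ((continuous_det_fderiv_T κ).inv₀ fun x =>
      abs_ne_zero.2 (det_fderiv_T_ne_zero hκ x)).mul ?_
    exact (continuous_fderiv_T κ).norm.mul (continuous_const.mul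
      ((continuous_fderiv_T κ).norm.rpow_const fun _ => Or.inr (by linarith)))
  obtain ⟨C, hC⟩ := hKu.exists_bound_of_continuousOn hcont.continuousOn
  obtain ⟨V, hV, hKV, hVD, hVc⟩ := exists_open_between_and_isCompact_closure hK hD hKD
  have hfin : volume V ≠ ⊤ := ((measure_mono subset_closure).trans_lt hVc.measure_lt_top).ne
  have : IsFiniteMeasure (volume.restrict V) :=
    ⟨by rw [Measure.restrict_apply_univ]; exact hfin.lt_top⟩
  have h1 := (hu V hV hVc hVD).2.1.integrable_norm_rpow (by simpa using by linarith)
    ENNReal.ofReal_ne_top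
  rw [ENNReal.toReal_ofReal (by linarith)] at h1
  have h2 : IntegrableOn (fun ξ => |C| * (1 + ‖g ξ‖ ^ p)) V :=
    ((integrable_const (1 : ℝ)).add h1).const_mul |C|
  have hnn : ∀ ξ, 0 ≤ |C| * (1 + ‖g ξ‖ ^ p) := fun ξ => by positivity
  refine ⟨K.indicator fun ξ => |C| * (1 + ‖g ξ‖ ^ p),
    (integrable_indicator_iff hK.measurableSet).2 (h2.mono_set hKV),
    fun ξ => Set.indicator_nonneg (fun ξ _ => hnn ξ) ξ, ?_⟩
  have h3 := ae_D_of_ae_G hκ hF hFG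
    (ae_restrict_of_ae_restrict_of_subset Set.sdiff_subset hAα)
  filter_upwards [ae_restrict_of_ae_restrict_of_subset Set.inter_subset_left h3,
    ae_restrict_mem (measurableSet_upper hD.measurableSet)] with ξ h4 h5 hξK
  have h6 : unfold κ ξ = Tinv κ ξ := by rw [unfold, fold_of_nonneg (le_of_lt h5.2)]
  rw [Set.indicator_of_mem hξK, opB_of_pos A h5.2, ← h6]
  refine (norm_pushOp_le hp hα h4 _).trans ?_
  refine mul_le_mul ?_ (rpow_sub_one_le hp (norm_nonneg _)) (Real.rpow_nonneg (norm_nonneg _) _)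
    (abs_nonneg _)
  exact (le_abs_self _).trans ((hC _ ⟨ξ, hξK, rfl⟩).trans (le_abs_self C))

omit hb in
-- With an even gradient field and an even test function the two halves of the integral are equal,
-- and their sum is zero.
theorem upper_integral_eq_zero_of_even {A : E m → E m → E m} {g : E m → E m}
    (heven : ∀ᵐ ξ ∂(volume.restrict (D κ F)), g (P ξ) = P (g ξ))
    (hg : ∀ φ : E m → ℝ, IsTestFun (D κ F) φ →
      IntegrableOn (fun ξ => inner ℝ (opB κ A ξ (g ξ)) (gradient φ ξ)) (D κ F) ∧
      ∫ ξ in D κ F, inner ℝ (opB κ A ξ (g ξ)) (gradient φ ξ) = 0)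
    {ψ : E m → ℝ} (hψ : IsTestFun (D κ F) ψ) (hψP : ∀ ξ, ψ (P ξ) = ψ ξ) :
    IntegrableOn (fun ξ => inner ℝ (opB κ A ξ (g ξ)) (gradient ψ ξ)) (D κ F ∩ {ξ | 0 < ht ξ}) ∧
      ∫ ξ in D κ F ∩ {ξ | 0 < ht ξ}, inner ℝ (opB κ A ξ (g ξ)) (gradient ψ ξ) = 0 := by
  have hD := isOpen_D hκ hF hFG
  have hDP : ∀ ξ, P ξ ∈ D κ F ↔ ξ ∈ D κ F := fun ξ => P_mem_D hκ hFG
  obtain ⟨h1, h2⟩ := hg ψ hψ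
  refine ⟨h1.mono_set Set.inter_subset_left, ?_⟩
  have hgr : ∀ ξ, gradient ψ (P ξ) = P (gradient ψ ξ) := fun ξ => by
    have h3 := gradient_comp (f := ψ) (hψ.1.differentiable (by simp) (P ξ))
      (hasFDerivAt_P ξ).differentiableAt
    rw [adjoint_fderiv_P, funext hψP] at h3
    rw [h3, P_P]
  have h4 : (fun ξ => inner ℝ (opB κ A (P ξ) (g (P ξ))) (gradient ψ (P ξ)))
      =ᵐ[volume.restrict (D κ F ∩ {ξ | 0 < ht ξ})]
      fun ξ => inner ℝ (opB κ A ξ (g ξ)) (gradient ψ ξ) := by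
    filter_upwards [ae_restrict_of_ae_restrict_of_subset Set.inter_subset_left heven,
      ae_restrict_mem (measurableSet_upper hD.measurableSet)] with ξ h5 h6
    rw [h5, opB_P A h6.2, hgr, inner_P_P]
  rw [setIntegral_eq_upper hD.measurableSet hDP h1, integral_congr_ae h4] at h2
  linarith

omit hb in
/-- Smooth even test functions in the ball approximating the push-forward of a test function. -/
theorem exists_even_testFun {φ : E m → ℝ} (hφ : IsTestFun (T κ ⁻¹' D κ F) φ) :
    ∃ (ψ : ℕ → E m → ℝ) (K : Set (E m)) (C : ℝ), IsCompact K ∧ K ⊆ D κ F ∧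
      (∀ k, IsTestFun (D κ F) (ψ k)) ∧ (∀ k ξ, ψ k (P ξ) = ψ k ξ) ∧
      (∀ k ξ, ξ ∉ K → gradient (ψ k) ξ = 0) ∧ (∀ k ξ, ‖gradient (ψ k) ξ‖ ≤ C) ∧
      ∀ ξ, 0 < ht ξ → Tendsto (fun k => gradient (ψ k) ξ) atTop
        (𝓝 (gradient (fun η => φ (Tinv κ η)) ξ)) := by
  obtain ⟨h1, h2, h3⟩ := hφ
  have hD := isOpen_D hκ hF hFG
  have hQ : IsCompact (T κ '' tsupport φ) := IsCompact.image h2 (continuous_T κ)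
  have hQD : T κ '' tsupport φ ⊆ D κ F := by
    rintro _ ⟨x, hx, rfl⟩; exact h3 hx
  have hQs : T κ '' tsupport φ ⊆ slit m := by
    rintro _ ⟨x, hx, rfl⟩; exact T_mem_slit κ x
  -- If `foldEps (e k) ξ` lies in the image of the support, then `fold ξ` is within `δ` of it. All
  -- the supports thus lie in one compact subset of `D`.
  obtain ⟨δ, hδ, hδD⟩ := hQ.exists_cthickening_subset_open hD hQD
  set Q := T κ '' tsupport φ with hQdef
  have hN : IsCompact (Metric.cthickening δ Q) := hQ.cthickening
  have hKc : IsClosed (fold ⁻¹' Metric.cthickening δ Q) :=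
    Metric.isClosed_cthickening.preimage continuous_fold
  have hK : IsCompact (fold ⁻¹' Metric.cthickening δ Q) := by
    refine (hN.union (hN.image continuous_P)).of_isClosed_subset hKc fun ξ hξ => ?_
    have hξ' : fold ξ ∈ Metric.cthickening δ Q := hξ
    rcases le_total 0 (ht ξ) with h | h
    · rw [fold_of_nonneg h] at hξ'; exact Or.inl hξ'
    · rw [fold_of_nonpos h] at hξ'; exact Or.inr ⟨P ξ, hξ', P_P ξ⟩
  have hKD : fold ⁻¹' Metric.cthickening δ Q ⊆ D κ F := fun ξ hξ =>
    (fold_mem_D hκ hFG).1 (hδD hξ)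
  set e : ℕ → ℝ := fun k => δ / (k + 1) with he
  have hepos : ∀ k, 0 < e k := fun k => by positivity
  have hele : ∀ k, e k ≤ δ := fun k => div_le_self hδ.le (by simp)
  have helim : Tendsto e atTop (𝓝 0) := by
    have h := (tendsto_one_div_add_atTop_nhds_zero_nat (𝕜 := ℝ)).const_mul δ
    simpa [he, div_eq_mul_inv] using h
  set f : E m → ℝ := fun η => φ (Tinv κ η) with hf
  have hfs : ContDiffOn ℝ ∞ f (slit m) := h1.comp_contDiffOn (contDiffOn_Tinv κ)
  have hfg : ContinuousOn (gradient f) (slit m) := continuousOn_gradient isOpen_slit hfs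
  have hf0 : ∀ η ∈ slit m, η ∉ Q → f η = 0 := fun η hη hηQ => by
    by_contra hne
    exact hηQ ⟨_, subset_tsupport _ hne, T_Tinv_slit hκ hη⟩
  have hfg0 : ∀ η ∈ slit m, η ∉ Q → gradient f η = 0 := fun η hη hηQ => by
    have h4 : f =ᶠ[𝓝 η] fun _ => (0 : ℝ) := by
      filter_upwards [isOpen_slit.mem_nhds hη, hQ.isClosed.isOpen_compl.mem_nhds hηQ] with y hy hy'
      exact hf0 y hy hy'
    rw [gradient_congr h4, gradient_fun_const]
  obtain ⟨C₁, hC₁⟩ := hQ.exists_bound_of_continuousOn (hfg.mono hQs)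
  obtain ⟨C₂, hC₂⟩ := exists_norm_scaleLast_le m
  clear_value f e
  have hslit : ∀ k ξ, foldEps (e k) ξ ∈ slit m := fun k ξ => by
    have h4 := ht_foldEps_pos (hepos k) ξ
    exact mem_slit_of_nonneg h4.le (by intro h; rw [h, ht_zero] at h4; exact lt_irrefl _ h4)
  have hgr : ∀ k ξ, gradient (fun ξ => f (foldEps (e k) ξ)) ξ =
      ContinuousLinearMap.adjoint (scaleLast m (ht ξ / √(ht ξ ^ 2 + e k ^ 2)))
        (gradient f (foldEps (e k) ξ)) := fun k ξ => by
    rw [gradient_comp ((hfs.contDiffAt (isOpen_slit.mem_nhds (hslit k ξ))).differentiableAt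
      (by simp)) (hasFDerivAt_foldEps (hepos k) ξ).differentiableAt,
      (hasFDerivAt_foldEps (hepos k) ξ).fderiv]
  have hsupp : ∀ k, tsupport (fun ξ => f (foldEps (e k) ξ)) ⊆ fold ⁻¹' Metric.cthickening δ Q := by
    refine fun k => closure_minimal (fun ξ hξ => ?_) hKc
    have h4 : foldEps (e k) ξ ∈ Q := by
      by_contra h; exact hξ (hf0 _ (hslit k ξ) h)
    refine Metric.mem_cthickening_of_dist_le (fold ξ) (foldEps (e k) ξ) δ Q h4 ?_
    rw [dist_comm]
    exact (dist_foldEps_fold (hepos k) ξ).trans (hele k)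
  -- `C₂` bounds the differential of `foldEps` and `C₁` the gradient of `f` on `Q`; the absolute
  -- value covers an empty `Q`, where `C₁` may be negative.
  refine ⟨fun k ξ => f (foldEps (e k) ξ), fold ⁻¹' Metric.cthickening δ Q, C₂ * |C₁|, hK, hKD,
    fun k => ⟨?_, hK.of_isClosed_subset (isClosed_tsupport _) (hsupp k), (hsupp k).trans hKD⟩,
    fun k ξ => by simp only [foldEps_P], fun k ξ hξ => ?_, fun k ξ => ?_, fun ξ hξ => ?_⟩
  · rw [← contDiffOn_univ]
    exact ContDiffOn.comp hfs (contDiff_foldEps (hepos k)).contDiffOn fun ξ _ => hslit k ξ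
  · by_contra h
    exact hξ (hsupp k (support_gradient_subset _ h))
  · rw [hgr]
    refine (ContinuousLinearMap.le_opNorm _ _).trans ?_
    rw [LinearIsometryEquiv.norm_map]
    have h4 : ‖scaleLast m (ht ξ / √(ht ξ ^ 2 + e k ^ 2))‖ ≤ C₂ := by
      refine hC₂ _ ?_
      rw [abs_div, abs_of_nonneg (Real.sqrt_nonneg _)]
      exact div_le_one_of_le₀ (Real.abs_le_sqrt (by nlinarith [hepos k])) (Real.sqrt_nonneg _)
    refine mul_le_mul h4 ?_ (norm_nonneg _) ((norm_nonneg _).trans h4)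
    by_cases h5 : foldEps (e k) ξ ∈ Q
    · exact (hC₁ _ h5).trans (le_abs_self _)
    · rw [hfg0 _ (hslit k ξ) h5, norm_zero]; exact abs_nonneg _
  · have hξs : ξ ∈ slit m :=
      mem_slit_of_nonneg hξ.le (by rintro rfl; rw [ht_zero] at hξ; exact lt_irrefl _ hξ)
    have h4 : Tendsto (fun k => foldEps (e k) ξ) atTop (𝓝 ξ) := by
      simpa only [fold_of_nonneg hξ.le] using tendsto_foldEps hepos helim ξ
    have h5 : Tendsto (fun k => gradient f (foldEps (e k) ξ)) atTop (𝓝 (gradient f ξ)) :=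
      (hfg.continuousAt (isOpen_slit.mem_nhds hξs)).tendsto.comp h4
    have h6 : Tendsto (fun k => ht ξ / √(ht ξ ^ 2 + e k ^ 2)) atTop (𝓝 1) := by
      have h7 := ((helim.pow 2).const_add (ht ξ ^ 2)).sqrt
      have h8 := (tendsto_const_nhds (x := ht ξ)).div h7
        (by rw [zero_pow two_ne_zero, add_zero, Real.sqrt_sq hξ.le]; exact hξ.ne')
      rw [zero_pow two_ne_zero, add_zero, Real.sqrt_sq hξ.le, div_self hξ.ne'] at h8
      exact h8
    have h9 : Tendsto (fun k => ContinuousLinearMap.adjoint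
        (scaleLast m (ht ξ / √(ht ξ ^ 2 + e k ^ 2)))) atTop
        (𝓝 (ContinuousLinearMap.adjoint (scaleLast m 1))) :=
      (ContinuousLinearMap.adjoint (𝕜 := ℝ) (E := E m) (F := E m)).continuous.tendsto _ |>.comp
        ((continuous_scaleLast (m := m)).tendsto _ |>.comp h6)
    have h10 := (isBoundedBilinearMap_apply (𝕜 := ℝ) (E := E m) (F := E m)).continuous.tendsto
      (ContinuousLinearMap.adjoint (scaleLast m 1), gradient f ξ) |>.comp (h9.prodMk_nhds h5)
    rw [scaleLast_one, ContinuousLinearMap.adjoint_id] at h10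
    exact h10.congr fun k => (hgr k ξ).symm

/-- The even reflection of `φ ∘ T⁻¹` may have a kink on the hyperplane, so it is not an admissible
test function. Its smooth even approximants have vanishing upper integrals, and the limit inherits
this by dominated convergence. -/
theorem isMixedWeakSol_comp_T {p : ℝ} (hp : 1 < p) {A : E m → E m → E m} (hA : IsElliptic p A)
    {u : E m → ℝ} (hu : IsWeakSol p (opB κ A) (D κ F) u)
    (heven : ∀ᵐ ξ ∂(volume.restrict (D κ F)), u (P ξ) = u ξ) :
    IsMixedWeakSol p A F (fun x => u (T κ x)) := by
  obtain ⟨g, hu, hg⟩ := hu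
  have hD := isOpen_D hκ hF hFG
  have hS : MeasurableSet (G m \ F) := isOpen_G.measurableSet.diff hF.measurableSet
  have hU : MeasurableSet (D κ F ∩ {ξ | 0 < ht ξ}) := measurableSet_upper hD.measurableSet
  rw [isSobolevGradLoc_wMeasure_iff fun ξ h => ne_zero_of_mem_D hκ hFG h] at hu
  have hgeven := hu.gradient_even hκ hF hFG hp.le heven
  obtain ⟨v, h, hv, hv1, hh⟩ := exists_extension hκ hF hFG hb hp.le hu
  refine ⟨v, h, ?_, hv, fun φ hφ => ?_⟩
  · have hm : MeasurableSet (closure (G m) \ F) := isClosed_closure.measurableSet.diff hF.measurableSet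
    filter_upwards [ae_restrict_mem hm] with x hx
    exact (hv1 x (closure_G_subset hx.1) hx.2).symm
  -- reduce to a test function supported in `T⁻¹(D)`
  have hO : IsOpen (T κ ⁻¹' D κ F) := hD.preimage (continuous_T κ)
  obtain ⟨θ, hθ, hθφ⟩ := exists_isTestFun_eq hO
    (IsCompact.inter_right hφ.2.1 isClosed_closedCyl)
    (fun x hx => T_mem_D hκ hF hFG hb hx.2 (hφ.2.2 hx.1)) hφ.1.contDiffOn
  have hθeq : ∀ x ∈ G m, θ x = φ x := fun x hx => hθφ x fun hxK =>
    image_eq_zero_of_notMem_tsupport fun hxt => hxK ⟨hxt, G_subset_closedCyl hx⟩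
  obtain ⟨ψ, K, C, hK, hKD, h1, h2, h3, h4, h5⟩ := exists_even_testFun hκ hF hFG hθ
  obtain ⟨b, hb1, hb2, hb3⟩ := exists_integrable_bound hκ hFG hp hA hD hF hu hK hKD
  have h6 := fun k => upper_integral_eq_zero_of_even hκ hF hFG hgeven hg (h1 k) (h2 k)
  have hbound : ∀ k, ∀ᵐ ξ ∂(volume.restrict (D κ F ∩ {ξ | 0 < ht ξ})),
      ‖inner ℝ (opB κ A ξ (g ξ)) (gradient (ψ k) ξ)‖ ≤ b ξ * C := fun k => by
    filter_upwards [hb3] with ξ hξ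
    have hC0 : 0 ≤ C := (norm_nonneg _).trans (h4 k ξ)
    by_cases hξK : ξ ∈ K
    · exact (norm_inner_le_norm _ _).trans
        (mul_le_mul (hξ hξK) (h4 k ξ) (norm_nonneg _) (hb2 ξ))
    · rw [h3 k ξ hξK, inner_zero_right, norm_zero]
      exact mul_nonneg (hb2 ξ) hC0
  have hlim : ∀ᵐ ξ ∂(volume.restrict (D κ F ∩ {ξ | 0 < ht ξ})),
      Tendsto (fun k => inner ℝ (opB κ A ξ (g ξ)) (gradient (ψ k) ξ)) atTop
        (𝓝 (inner ℝ (opB κ A ξ (g ξ)) (gradient (fun η => θ (Tinv κ η)) ξ))) := by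
    filter_upwards [ae_restrict_mem hU] with ξ hξ
    exact tendsto_const_nhds.inner (h5 ξ hξ.2)
  have hbi : IntegrableOn (fun ξ => b ξ * C) (D κ F ∩ {ξ | 0 < ht ξ}) :=
    (hb1.mul_const C).integrableOn
  have hI1 : IntegrableOn (fun ξ => inner ℝ (opB κ A ξ (g ξ))
      (gradient (fun η => θ (Tinv κ η)) ξ)) (D κ F ∩ {ξ | 0 < ht ξ}) := by
    refine Integrable.mono' hbi
      (aestronglyMeasurable_of_tendsto_ae atTop (fun k => (h6 k).1.1) hlim) ?_
    filter_upwards [hlim, ae_all_iff.2 hbound] with ξ h7 h8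
    exact le_of_tendsto h7.norm (Eventually.of_forall h8)
  have hI2 : ∫ ξ in D κ F ∩ {ξ | 0 < ht ξ}, inner ℝ (opB κ A ξ (g ξ))
      (gradient (fun η => θ (Tinv κ η)) ξ) = 0 := by
    have h7 := tendsto_integral_of_dominated_convergence (fun ξ => b ξ * C)
      (fun k => (h6 k).1.1) hbi hbound hlim
    simp only [fun k => (h6 k).2] at h7
    exact (tendsto_nhds_unique h7 tendsto_const_nhds)
  have hcongr : Set.EqOn
      (fun ξ => inner ℝ (opB κ A ξ (g ξ)) (gradient (fun η => θ (Tinv κ η)) ξ))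
      (fun ξ => inner ℝ (pushOp κ A (Tinv κ ξ) (g ξ)) (gradient (fun η => θ (Tinv κ η)) ξ))
      (D κ F ∩ {ξ | 0 < ht ξ}) := fun ξ hξ => by
    simp only [opB_of_pos A hξ.2]
  have hgr : ∀ x ∈ G m, ContinuousLinearMap.adjoint (fderiv ℝ (T κ) x)
      (gradient (fun η => θ (Tinv κ η)) (T κ x)) = gradient φ x := by
    intro x hx
    have hd : DifferentiableAt ℝ (fun η => θ (Tinv κ η)) (T κ x) :=
      (hθ.1.differentiable (by simp) _).comp _ (differentiableAt_Tinv κ (T_mem_slit κ x))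
    rw [← gradient_comp hd (differentiableAt_T κ x)]
    simp only [Tinv_T hκ]
    refine gradient_congr ?_
    filter_upwards [isOpen_G.mem_nhds hx] with y hy
    exact hθeq y hy
  have hcongr' : Set.EqOn (fun x => inner ℝ
      (A x (ContinuousLinearMap.adjoint (fderiv ℝ (T κ) x) (g (T κ x))))
      (ContinuousLinearMap.adjoint (fderiv ℝ (T κ) x)
        (gradient (fun η => θ (Tinv κ η)) (T κ x))))
      (fun x => inner ℝ (A x (h x)) (gradient φ x)) (G m \ F) := fun x hx => by
    simp only [hgr x hx.1, hh x hx.1 hx.2]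
  rw [integrableOn_congr_fun hcongr hU, ← T_image_G_diff hκ hF hFG hb,
    integrableOn_pushOp_iff hκ A hS g (gradient fun η => θ (Tinv κ η)),
    integrableOn_congr_fun hcongr' hS] at hI1
  rw [setIntegral_congr_fun hU hcongr, ← T_image_G_diff hκ hF hFG hb,
    setIntegral_pushOp hκ A hS g (gradient fun η => θ (Tinv κ η)),
    setIntegral_congr_fun hS hcongr'] at hI2
  exact ⟨hI1, hI2⟩

end Converse

end HalfCylinder

end

theorem mainTheorem6 {m : ℕ} (hm : 1 ≤ m) (p : ℝ) (hp : 1 < p) (κ : ℝ) (hκ : 0 < κ)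
    (A : HalfCylinder.E m → HalfCylinder.E m → HalfCylinder.E m)
    (hA : HalfCylinder.IsElliptic p A)
    (F : Set (HalfCylinder.E m)) (hF : IsClosed F)
    (hFG : F ⊆ closure (HalfCylinder.G m)) (hbase : HalfCylinder.base m ⊆ F) :
    (∀ u : HalfCylinder.E m → ℝ, HalfCylinder.IsMixedWeakSol p A F u →
      HalfCylinder.IsWeakSol p (HalfCylinder.opB κ A) (HalfCylinder.D κ F)
        (HalfCylinder.reflect κ u)) ∧
    (∀ ubar : HalfCylinder.E m → ℝ,
      HalfCylinder.IsWeakSol p (HalfCylinder.opB κ A) (HalfCylinder.D κ F) ubar →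
      (∀ᵐ ξ ∂(MeasureTheory.volume.restrict (HalfCylinder.D κ F)),
        ubar (HalfCylinder.P ξ) = ubar ξ) →
      HalfCylinder.IsMixedWeakSol p A F (fun x => ubar (HalfCylinder.T κ x))) := by
  refine ⟨fun u hu => ?_, fun ubar hu heven => ?_⟩
  · exact HalfCylinder.isWeakSol_reflect hκ hF hFG hbase hp.le hu
  · exact HalfCylinder.isMixedWeakSol_comp_T hκ hF hFG hbase hp hA hu heven
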